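/- **Theorem (Symplectic reduction of optical phase space).** Let $n:\mathbb R^3\to(0,\infty)$ be smooth, let $\Sigma=\{(q,p)\in T^*\mathbb R^3:\|p\|^2=n(q)^2\}$, with its structure of a smooth $5$-dimensional submanifold of $T^*\mathbb R^3$, and let $\alpha=\theta|_\Sigma$ be the restriction of the Liouville form $\theta=\sum_{i=1}^3 p_i\,dq_i$. Then at every point of $\Sigma$ there is exactly one tangent vector $R$ with $\alpha(R)=1$ and $\iota_R d\alpha=0$; the resulting vector field $R$ is the Reeb field. Write $x\sim y$ if some integral curve of $R$, defined on an open interval, passes through $x$ and $y$. This is an equivalence relation; its classes are the Reeb orbits. Let $\mathcal N=\Sigma/\!\sim$ carry the quotient topology, and let $\pi:\Sigma\to\mathcal N$ be the quotient map. Assume that the Reeb orbits form a regular family with closed orbit relation, that is: * every point of $\Sigma$ has an open neighbourhood $U$ and a smooth submersion $f:U\to\mathbb R^4$ such that for $x,y\in U$ one has $x\sim y$ if and only if $f(x)=f(y)$; * $\{(x,y)\in\Sigma\times\Sigma : x\sim y\}$ is closed in $\Sigma\times\Sigma$. Then: 1. $\mathcal N$ carries the structure of a smooth $4$-dimensional manifold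 (Hausdorff and second countable, with the quotient topology) for which $\pi$ is a smooth submersion. 2. For every such structure there is a unique $2$-form $\bar\omega$ on $\mathcal N$ with $\pi^*\bar\omega=d\alpha$ (unique among all, not necessarily smooth, $2$-forms). 3. This $\bar\omega$ is smooth, closed and non-degenerate, so that $(\mathcal N,\bar\omega)$ is a $4$-dimensional symplectic manifold. -/

import Mathlib

open scoped Manifold ContDiff Topology

noncomputable section

/-! ### Differential forms on manifolds -/

section Forms

variable {E : Type*} [NormedAddCommGroup E] [NormedSpace ℝ E]
  {H : Type*} [TopologicalSpace H] (I : ModelWithCorners ℝ E H)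
  {M : Type*} [TopologicalSpace M] [ChartedSpace H M]
  {E' : Type*} [NormedAddCommGroup E'] [NormedSpace ℝ E']
  {H' : Type*} [TopologicalSpace H'] (J : ModelWithCorners ℝ E' H')
  {N : Type*} [TopologicalSpace N] [ChartedSpace H' N]

variable (M) in
/-- A (not necessarily smooth) field of alternating `k`-forms on the tangent spaces of `M`. -/
abbrev DiffForm (k : ℕ) : Type _ :=
  ∀ x : M, (TangentSpace I x) [⋀^Fin k]→L[ℝ] ℝ

variable {I} {J}

/-- The pullback `f^* η`, that is `(f^* η)_x (v₁, …, v_k) = η_{f x} (df_x v₁, …, df_x v_k)`. -/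
def DiffForm.pullback {k : ℕ} (f : M → N) (η : DiffForm J N k) : DiffForm I M k :=
  fun x => (η (f x)).compContinuousLinearMap (mfderiv I J f x)

/-- The expression of `η` in the preferred chart around `x₀`: its pullback under the inverse
of that chart. It is meaningful on the target of the chart. -/
def DiffForm.inChart {k : ℕ} (η : DiffForm I M k) (x₀ : M) : E → E [⋀^Fin k]→L[ℝ] ℝ :=
  fun y => (η ((extChartAt I x₀).symm y)).compContinuousLinearMap
    (mfderivWithin 𝓘(ℝ, E) I (extChartAt I x₀).symm (Set.range I) y)

/-- A form is smooth if all its expressions in the preferred charts are. -/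
def DiffForm.IsSmooth {k : ℕ} (η : DiffForm I M k) : Prop :=
  ∀ x₀ : M, ContDiffOn ℝ ∞ (η.inChart x₀) (extChartAt I x₀).target

/-- The exterior derivative `dη`, computed at `x` in the preferred chart around `x`. -/
def DiffForm.extDeriv {k : ℕ} (η : DiffForm I M k) : DiffForm I M (k + 1) :=
  fun x => (extDerivWithin (η.inChart x) (Set.range I)
    (extChartAt I x x)).compContinuousLinearMap (mfderiv I 𝓘(ℝ, E) (extChartAt I x) x)

/-- A symplectic form: a smooth, closed and non-degenerate 2-form. -/
structure DiffForm.IsSymplectic (η : DiffForm I M 2) : Prop where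
  smooth : η.IsSmooth
  closed : η.extDeriv = 0
  nondegenerate : ∀ (x : M) (v : TangentSpace I x),
    (∀ w : TangentSpace I x, η x ![v, w] = 0) → v = 0

/-! ### Reeb vectors, Reeb orbits -/

/-- `v` satisfies the two equations `α(v) = 1` and `ι_v dα = 0` at the point `x`. -/
def DiffForm.IsReebVector (α : DiffForm I M 1) (x : M) (v : TangentSpace I x) : Prop :=
  α x ![v] = 1 ∧ ∀ w : TangentSpace I x, α.extDeriv x ![v, w] = 0

/-- The Reeb vector field `R` of `α`, determined by `α(R) = 1` and `ι_R dα = 0`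
(the two equations have a unique solution at every point when `α` is a contact form). -/
def DiffForm.reebField (α : DiffForm I M 1) (x : M) : TangentSpace I x :=
  Classical.epsilon (α.IsReebVector x)

/-- `x` and `y` lie on the same Reeb orbit: some integral curve of the Reeb field,
defined on an open interval of times, passes through both. -/
def DiffForm.SameReebOrbit (α : DiffForm I M 1) (x y : M) : Prop :=
  ∃ (γ : ℝ → M) (a b s t : ℝ), IsMIntegralCurveOn γ α.reebField (Set.Ioo a b) ∧
    s ∈ Set.Ioo a b ∧ t ∈ Set.Ioo a b ∧ γ s = x ∧ γ t = y

/-- The space of Reeb orbits, with the quotient topology. -/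
def DiffForm.OrbitSpace (α : DiffForm I M 1) : Type _ := Quot α.SameReebOrbit

instance (α : DiffForm I M 1) : TopologicalSpace α.OrbitSpace :=
  inferInstanceAs (TopologicalSpace (Quot α.SameReebOrbit))

/-- The quotient map, sending a point to its Reeb orbit. -/
def DiffForm.toOrbit (α : DiffForm I M 1) : M → α.OrbitSpace := Quot.mk _

/-- The foliation of the `(d+1)`-dimensional manifold `M` by Reeb orbits is regular: every
point has an open neighbourhood `U` with a submersion `f : U → ℝ^d` whose fibres are exactly
the traces on `U` of the Reeb orbits. -/
def DiffForm.IsRegularReeb (α : DiffForm I M 1) (d : ℕ) : Prop :=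
  ∀ x : M, ∃ U : Set M, IsOpen U ∧ x ∈ U ∧ ∃ f : M → EuclideanSpace ℝ (Fin d),
    ContMDiffOn I (𝓡 d) ∞ f U ∧
    (∀ y ∈ U, Function.Surjective (mfderiv I (𝓡 d) f y)) ∧
    ∀ y ∈ U, ∀ z ∈ U, (α.SameReebOrbit y z ↔ f y = f z)

/-- The given charts make `N` a smooth manifold (Hausdorff and second countable) for which
`π : M → N` is a smooth submersion. -/
structure IsQuotientManifold (I : ModelWithCorners ℝ E H) (J : ModelWithCorners ℝ E' H')
    (π : M → N) : Prop where
  hausdorff : T2Space N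
  secondCountable : SecondCountableTopology N
  isManifold : IsManifold J ∞ N
  smooth : ContMDiff I J ∞ π
  submersion : ∀ x : M, Function.Surjective (mfderiv I J π x)

end Forms

/-! ### The optical contact manifold -/

/-- Euclidean 3-space. -/
abbrev E3 : Type := EuclideanSpace ℝ (Fin 3)

/-- The cotangent bundle `T^*ℝ³` with its global coordinates `(q, p)`. -/
abbrev CotangentE3 : Type := E3 × E3

instance : ChartedSpace CotangentE3 CotangentE3 := chartedSpaceSelf CotangentE3

instance : Fact (Module.finrank ℝ E3 = 2 + 1) := ⟨finrank_euclideanSpace_fin⟩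

/-- The Liouville form `θ = ∑ pᵢ dqᵢ` on `T^*ℝ³`. -/
def liouville : DiffForm 𝓘(ℝ, CotangentE3) CotangentE3 1 :=
  fun x => ContinuousAlternatingMap.ofSubsingleton ℝ CotangentE3 ℝ (0 : Fin 1)
    ((innerSL ℝ x.2).comp (ContinuousLinearMap.fst ℝ E3 E3))

/-- An optical medium: a smooth positive refractive index `n` on `ℝ³`. -/
structure OpticalMedium where
  n : E3 → ℝ
  smooth : ContDiff ℝ ∞ n
  pos : ∀ q, 0 < n q

namespace OpticalMedium

variable (m : OpticalMedium)

/-- The optical Hamiltonian `H(q, p) = ‖p‖² - n(q)²`. -/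
def hamiltonian (x : CotangentE3) : ℝ := ‖x.2‖ ^ 2 - m.n x.1 ^ 2

/-- The hypersurface `Σ = H⁻¹(0)`. -/
def Hypersurface : Type := {x : CotangentE3 // m.hamiltonian x = 0}

/-- The inclusion of `Σ` into `T^*ℝ³`. -/
def incl : m.Hypersurface → CotangentE3 := Subtype.val

instance : TopologicalSpace m.Hypersurface :=
  inferInstanceAs (TopologicalSpace {x : CotangentE3 // m.hamiltonian x = 0})

theorem norm_snd (x : m.Hypersurface) : ‖(m.incl x).2‖ = m.n (m.incl x).1 := by
  have h : ‖(m.incl x).2‖ ^ 2 - m.n (m.incl x).1 ^ 2 = 0 := x.2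
  exact (sq_eq_sq₀ (norm_nonneg _) (m.pos _).le).1 (by linarith)

/-- `Σ` is diffeomorphic to `ℝ³ × S²` through `(q, p) ↦ (q, p / n(q))`; this homeomorphism
is used to give `Σ` its smooth structure. -/
def homeo : m.Hypersurface ≃ₜ E3 × Metric.sphere (0 : E3) 1 where
  toFun x := ((m.incl x).1, ⟨(m.n (m.incl x).1)⁻¹ • (m.incl x).2, by
    have := m.pos (m.incl x).1
    rw [mem_sphere_zero_iff_norm, norm_smul, m.norm_snd, Real.norm_of_nonneg (by positivity),
      inv_mul_cancel₀ this.ne']⟩)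
  invFun y := ⟨(y.1, m.n y.1 • (y.2 : E3)), by
    have h : ‖(y.2 : E3)‖ = 1 := mem_sphere_zero_iff_norm.1 y.2.2
    simp [hamiltonian, norm_smul, h]⟩
  left_inv x := by
    apply Subtype.ext
    have := (m.pos (m.incl x).1).ne'
    refine Prod.ext rfl ?_
    exact smul_inv_smul₀ this (m.incl x).2
  right_inv y := by
    have := (m.pos y.1).ne'
    refine Prod.ext rfl (Subtype.ext ?_)
    exact inv_smul_smul₀ this (y.2 : E3)
  continuous_toFun := by
    have hc : Continuous m.incl := continuous_subtype_val
    have hn : Continuous m.n := m.smooth.continuous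
    refine (continuous_fst.comp hc).prodMk (Continuous.subtype_mk ?_ _)
    exact ((hn.comp (continuous_fst.comp hc)).inv₀ fun x => (m.pos _).ne').smul
      (continuous_snd.comp hc)
  continuous_invFun := by
    have hn : Continuous m.n := m.smooth.continuous
    refine Continuous.subtype_mk ?_ _
    exact continuous_fst.prodMk ((hn.comp continuous_fst).smul
      (continuous_subtype_val.comp continuous_snd))

/-- The model of `Σ`, of dimension `3 + 2 = 5`. -/
abbrev model : ModelWithCorners ℝ (E3 × EuclideanSpace ℝ (Fin 2))
    (ModelProd E3 (EuclideanSpace ℝ (Fin 2))) := 𝓘(ℝ, E3).prod (𝓡 2)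

/-- The smooth structure of `Σ` as a submanifold of `T^*ℝ³` (see `contMDiff_incl` and
`mfderiv_incl_injective`). -/
instance : ChartedSpace (ModelProd E3 (EuclideanSpace ℝ (Fin 2))) m.Hypersurface where
  atlas := {e | ∃ c ∈ atlas (ModelProd E3 (EuclideanSpace ℝ (Fin 2)))
    (E3 × Metric.sphere (0 : E3) 1), e = m.homeo.toOpenPartialHomeomorph.trans c}
  chartAt x := m.homeo.toOpenPartialHomeomorph.trans (chartAt _ (m.homeo x))
  mem_chart_source x := by simp
  chart_mem_atlas x := ⟨_, chart_mem_atlas _ _, rfl⟩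

instance : IsManifold model ∞ m.Hypersurface where
  compatible := by
    rintro _ _ ⟨c, hc, rfl⟩ ⟨c', hc', rfl⟩
    have h := HasGroupoid.compatible (G := contDiffGroupoid ∞ model) hc hc'
    refine (contDiffGroupoid ∞ model).mem_of_eqOnSource h ?_
    refine ⟨?_, ?_⟩
    · ext y
      simp
    · intro y hy
      simp

theorem contMDiff_homeo : ContMDiff model model ∞ m.homeo := by
  intro x
  have h1 := contMDiffAt_of_mem_maximalAtlas (I := model) (n := ∞)
    (IsManifold.chart_mem_maximalAtlas (I := model) (n := ∞) x)
    (mem_chart_source (ModelProd E3 (EuclideanSpace ℝ (Fin 2))) x)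
  have h2 := contMDiffAt_symm_of_mem_maximalAtlas (I := model) (n := ∞)
    (IsManifold.chart_mem_maximalAtlas (I := model) (n := ∞) (m.homeo x))
    (mem_chart_target (ModelProd E3 (EuclideanSpace ℝ (Fin 2))) (m.homeo x))
  refine (ContMDiffAt.comp x h2 h1).congr_of_eventuallyEq ?_
  filter_upwards [(chartAt (ModelProd E3 (EuclideanSpace ℝ (Fin 2))) x).open_source.mem_nhds
    (mem_chart_source _ x)] with y hy
  exact ((chartAt (ModelProd E3 (EuclideanSpace ℝ (Fin 2))) (m.homeo x)).left_inv hy.2).symm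

theorem contMDiff_homeo_symm : ContMDiff model model ∞ m.homeo.symm := by
  intro z
  obtain ⟨x, rfl⟩ := m.homeo.surjective z
  have h1 := contMDiffAt_of_mem_maximalAtlas (I := model) (n := ∞)
    (IsManifold.chart_mem_maximalAtlas (I := model) (n := ∞) (m.homeo x))
    (mem_chart_source (ModelProd E3 (EuclideanSpace ℝ (Fin 2))) (m.homeo x))
  have h2 := contMDiffAt_symm_of_mem_maximalAtlas (I := model) (n := ∞)
    (IsManifold.chart_mem_maximalAtlas (I := model) (n := ∞) x)
    (mem_chart_target (ModelProd E3 (EuclideanSpace ℝ (Fin 2))) x)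
  refine (ContMDiffAt.comp (m.homeo x) h2 h1).congr_of_eventuallyEq ?_
  filter_upwards [(chartAt (ModelProd E3 (EuclideanSpace ℝ (Fin 2)))
    (m.homeo x)).open_source.mem_nhds (mem_chart_source _ _)] with y hy
  exact congrArg m.homeo.symm
    ((chartAt (ModelProd E3 (EuclideanSpace ℝ (Fin 2))) (m.homeo x)).left_inv hy).symm

/-- The inclusion of `Σ` is smooth. -/
theorem contMDiff_incl : ContMDiff model 𝓘(ℝ, CotangentE3) ∞ m.incl := by
  have hg : ContMDiff model 𝓘(ℝ, CotangentE3) ∞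
      (fun y : E3 × Metric.sphere (0 : E3) 1 => ((y.1, m.n y.1 • (y.2 : E3)) : CotangentE3)) :=
    contMDiff_fst.prodMk_space
      ((m.smooth.contMDiff.comp contMDiff_fst).smul (contMDiff_coe_sphere.comp contMDiff_snd))
  have h := hg.comp m.contMDiff_homeo
  refine h.congr fun x => ?_
  exact congrArg m.incl (m.homeo.symm_apply_apply x).symm

/-- The inclusion of `Σ` is an immersion. -/
theorem mfderiv_incl_injective (x : m.Hypersurface) :
    Function.Injective (mfderiv model 𝓘(ℝ, CotangentE3) m.incl x) := by
  let r : CotangentE3 → E3 × E3 := fun y => (y.1, (m.n y.1)⁻¹ • y.2)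
  have hr : ContMDiff 𝓘(ℝ, CotangentE3) (𝓘(ℝ, E3).prod 𝓘(ℝ, E3)) ∞ r := by
    have h2 : ContDiff ℝ ∞ (fun y : CotangentE3 => (m.n y.1)⁻¹ • y.2) :=
      ((m.smooth.comp contDiff_fst).inv fun y => (m.pos _).ne').smul contDiff_snd
    exact ContMDiff.prodMk contDiff_fst.contMDiff h2.contMDiff
  have hcoe : ContMDiff (𝓡 2) 𝓘(ℝ, E3) ∞ ((↑) : Metric.sphere (0 : E3) 1 → E3) :=
    contMDiff_coe_sphere
  have h0 : (∞ : WithTop ℕ∞) ≠ 0 := by simp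
  have hd : mfderiv model (𝓘(ℝ, E3).prod 𝓘(ℝ, E3)) (r ∘ m.incl) x =
      mfderiv model (𝓘(ℝ, E3).prod 𝓘(ℝ, E3)) (Prod.map (id : E3 → E3)
        ((↑) : Metric.sphere (0 : E3) 1 → E3) ∘ m.homeo) x := rfl
  rw [mfderiv_comp (I' := 𝓘(ℝ, CotangentE3)) x (hr.mdifferentiableAt h0)
      (m.contMDiff_incl.mdifferentiableAt h0),
    mfderiv_comp (I' := model) x
      ((contMDiff_id.prodMap hcoe).mdifferentiableAt h0)
      (m.contMDiff_homeo.mdifferentiableAt h0),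
    mfderiv_prodMap mdifferentiableAt_id (hcoe.mdifferentiableAt h0)] at hd
  have hinj1 : Function.Injective (mfderiv model model m.homeo x) := by
    have e : m.homeo.symm ∘ m.homeo = id := funext m.homeo.symm_apply_apply
    have h : mfderiv model model (m.homeo.symm ∘ m.homeo) x =
        mfderiv model model (id : m.Hypersurface → m.Hypersurface) x := by rw [e]
    rw [mfderiv_comp (I' := model) x (m.contMDiff_homeo_symm.mdifferentiableAt h0)
      (m.contMDiff_homeo.mdifferentiableAt h0), mfderiv_id] at h
    intro v w hvw
    have hv := DFunLike.congr_fun h v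
    have hw := DFunLike.congr_fun h w
    simp only [ContinuousLinearMap.comp_apply] at hv hw
    rw [hvw] at hv
    exact hv.symm.trans hw
  have hinj2 : Function.Injective (mfderiv (𝓡 2) 𝓘(ℝ, E3)
      ((↑) : Metric.sphere (0 : E3) 1 → E3) (m.homeo x).2) :=
    injective_mvfderiv_subtypeVal_sphere (n := 2) (m.homeo x).2
  intro v w hvw
  apply hinj1
  have hv := DFunLike.congr_fun hd v
  have hw := DFunLike.congr_fun hd w
  simp only [ContinuousLinearMap.comp_apply] at hv hw
  rw [hvw] at hv
  have hvw' := hv.symm.trans hw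
  rw [mfderiv_id] at hvw'
  refine Prod.ext ?_ (hinj2 ?_)
  · exact (congrArg (fun z : E3 × E3 => z.1) hvw' :)
  · exact (congrArg (fun z : E3 × E3 => z.2) hvw' :)

/-- The contact form `α = θ|_Σ`. -/
def contactForm : DiffForm model m.Hypersurface 1 := liouville.pullback m.incl

end OpticalMedium

end

/-! The tangent space of `Σ` is the kernel of `dH`, a hyperplane of `T^*ℝ³`, so the restriction of
`dθ` to it has a one-dimensional kernel, spanned by the Hamiltonian vector. On that vector,
proportional to `(p, n∇n)`, `θ` is nonzero because `‖p‖² = n² > 0`, and normalising gives the unique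
Reeb vector (`isReebVector_iff`). It depends smoothly on the point, so uniqueness of integral curves
makes the orbit relation an equivalence.

The form descends because `ι_R dα = 0` and `dα` is closed, hence `L_R dα = 0`. This is used without
flows. In a box that straightens the local submersion `f`, the coefficients of `dα` are constant
along the fibres (`pairing_fderiv_eq_of_horizontal`), so sliding along a fibre preserves `dα`.
Chaining such slides along an orbit yields, for any two of its points, a germ of a smooth map from
one to the other that respects orbits and preserves `dα` at the base point
(`orbitGerm_of_sameReebOrbit`).

These germs carry the rest. They make `π` open, and they transport charts and sections from one
point of an orbit to another, so the maps `f` become charts of the orbit space; the closed relation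
then gives Hausdorffness. They also show that the value of the reduced form does not depend on the
point chosen on the orbit. Since `5 - 4 = 1`, the kernel of `dπ` is the Reeb line, which is the
kernel of `dα`: this gives non-degeneracy. If `σ` is a local section of `π`, the reduced form is
locally `d((incl ∘ σ)^* θ)`, hence smooth and closed. Uniqueness holds because `π` and every `dπ`
are surjective. -/

section PullbackToManifold

/-! ### Exterior derivative and pullback from a vector space. -/

variable {E : Type*} [NormedAddCommGroup E] [NormedSpace ℝ E]
  {H : Type*} [TopologicalSpace H] {I : ModelWithCorners ℝ E H} [I.Boundaryless]
  {M : Type*} [TopologicalSpace M] [ChartedSpace H M] [IsManifold I ∞ M]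
  {F : Type*} [NormedAddCommGroup F] [NormedSpace ℝ F]

theorem contMDiffAt_extChartAt_symm (x₀ : M) {y : E} (hy : y ∈ (extChartAt I x₀).target) :
    ContMDiffAt 𝓘(ℝ, E) I ∞ (extChartAt I x₀).symm y :=
  (contMDiffOn_extChartAt_symm x₀).contMDiffAt
    ((isOpen_extChartAt_target x₀).mem_nhds hy)

/-- The exterior derivative on a manifold commutes with pullback from a vector space. -/
theorem diffForm_extDeriv_pullback {k : ℕ} (η : F → F [⋀^Fin k]→L[ℝ] ℝ) {f : M → F}
    (hf : ContMDiff I 𝓘(ℝ, F) ∞ f) (hη : Differentiable ℝ η) (x : M) :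
    (DiffForm.pullback (I := I) (J := 𝓘(ℝ, F)) f η).extDeriv x =
      (extDeriv η (f x)).compContinuousLinearMap (mfderiv I 𝓘(ℝ, F) f x) := by
  have h0 : (∞ : WithTop ℕ∞) ≠ 0 := by simp
  set φ := extChartAt I x
  have hF : ∀ y ∈ φ.target, ContDiffAt ℝ ∞ (f ∘ φ.symm) y := fun y hy =>
    (hf.contMDiffAt.comp y (contMDiffAt_extChartAt_symm x hy)).contDiffAt
  have hφ : φ.target ∈ 𝓝 (φ x) := extChartAt_target_mem_nhds x
  -- In the chart the pulled back form is the ordinary pullback of `η` under `f ∘ φ.symm`, so the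
  -- vector space identity `extDeriv_pullback` applies.
  have hev : (DiffForm.pullback (I := I) (J := 𝓘(ℝ, F)) f η).inChart x =ᶠ[𝓝 (φ x)]
      fun y => (η ((f ∘ φ.symm) y)).compContinuousLinearMap (fderiv ℝ (f ∘ φ.symm) y) := by
    filter_upwards [hφ] with y hy
    have : fderiv ℝ (f ∘ φ.symm) y = (mfderiv I 𝓘(ℝ, F) f (φ.symm y)).comp
        (mfderiv 𝓘(ℝ, E) I φ.symm y) := by
      rw [← mfderiv_eq_fderiv]
      exact mfderiv_comp y (hf.mdifferentiableAt h0)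
        ((contMDiffAt_extChartAt_symm x hy).mdifferentiableAt h0)
    rw [this]
    unfold DiffForm.inChart
    rw [I.range_eq_univ, mfderivWithin_univ]
    rfl
  have hmf : mfderiv I 𝓘(ℝ, F) f x =
      (fderiv ℝ (f ∘ φ.symm) (φ x)).comp (mfderiv I 𝓘(ℝ, E) φ x) := by
    have h1 := mfderiv_comp x
      ((hF _ (mem_extChartAt_target x)).differentiableAt h0).mdifferentiableAt
      (mdifferentiableAt_extChartAt (I := I) (mem_chart_source H x))
    have h2 : f =ᶠ[𝓝 x] (f ∘ φ.symm) ∘ φ := by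
      filter_upwards [extChartAt_source_mem_nhds (I := I) x] with y hy
      exact congrArg f (φ.left_inv hy).symm
    rw [mfderiv_eq_fderiv] at h1
    exact h2.mfderiv_eq.trans h1
  unfold DiffForm.extDeriv
  rw [I.range_eq_univ, extDerivWithin_univ, hev.extDeriv_eq,
    extDeriv_pullback hη.differentiableAt (hF _ (mem_extChartAt_target x))
      (by rw [minSmoothness_of_isRCLikeNormedField]; exact WithTop.coe_le_coe.2 le_top), hmf]
  simp only [Function.comp_apply, φ, extChartAt_to_inv]
  rfl

end PullbackToManifold

/-! ### The canonical symplectic form of `T^*ℝ³`. -/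

/-- The covector `p ↦ ∑ pᵢ dqᵢ` of the Liouville form. -/
noncomputable def liouvilleCovector : CotangentE3 →L[ℝ] CotangentE3 →L[ℝ] ℝ :=
  ((ContinuousLinearMap.compL ℝ CotangentE3 E3 ℝ).flip (ContinuousLinearMap.fst ℝ E3 E3)).comp
    ((innerSL ℝ).comp (ContinuousLinearMap.snd ℝ E3 E3))

/-- The Liouville form, as a linear function of the base point. -/
noncomputable def liouvilleForm : CotangentE3 →L[ℝ] CotangentE3 [⋀^Fin 1]→L[ℝ] ℝ :=
  (ContinuousAlternatingMap.ofSubsingletonLIE (0 : Fin 1) :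
    (CotangentE3 →L[ℝ] ℝ) ≃ₗᵢ[ℝ] _).toContinuousLinearEquiv.toContinuousLinearMap.comp
      liouvilleCovector

/-- The canonical symplectic form `dθ` of `T^*ℝ³`, which is constant. -/
noncomputable def canonicalTwoForm : CotangentE3 [⋀^Fin 2]→L[ℝ] ℝ :=
  extDeriv liouvilleForm 0

theorem extDeriv_liouvilleForm (x : CotangentE3) :
    extDeriv liouvilleForm x = canonicalTwoForm := by
  unfold canonicalTwoForm extDeriv
  rw [liouvilleForm.fderiv, liouvilleForm.fderiv]

/-- The canonical symplectic form, as a bilinear map. -/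
noncomputable def canonicalPairing : CotangentE3 →L[ℝ] CotangentE3 →L[ℝ] ℝ :=
  liouvilleCovector - liouvilleCovector.flip

theorem canonicalPairing_apply (v w : CotangentE3) :
    canonicalPairing v w = inner ℝ v.2 w.1 - inner ℝ w.2 v.1 := by
  simp [canonicalPairing, liouvilleCovector]

theorem canonicalTwoForm_apply (v w : CotangentE3) :
    canonicalTwoForm ![v, w] = canonicalPairing v w := by
  rw [canonicalPairing_apply]
  unfold canonicalTwoForm extDeriv
  rw [liouvilleForm.fderiv, ContinuousAlternatingMap.alternatizeUncurryFin_apply]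
  simp [Fin.sum_univ_two, liouvilleForm, liouvilleCovector, Fin.removeNth,
    ContinuousAlternatingMap.ofSubsingletonLIE, sub_eq_add_neg]

/-! ### Tangent spaces of `Σ`, the kernel of `dα`, and Reeb vectors. -/

namespace OpticalMedium

variable (m : OpticalMedium)

/-- The differential of the inclusion `Σ → T^*ℝ³`. -/
noncomputable def dincl (x : m.Hypersurface) :
    E3 × EuclideanSpace ℝ (Fin 2) →L[ℝ] CotangentE3 :=
  mfderiv model 𝓘(ℝ, CotangentE3) m.incl x

theorem dincl_injective (x : m.Hypersurface) : Function.Injective (m.dincl x) :=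
  m.mfderiv_incl_injective x

theorem extDeriv_contactForm (x : m.Hypersurface) :
    m.contactForm.extDeriv x = canonicalTwoForm.compContinuousLinearMap (m.dincl x) := by
  rw [← extDeriv_liouvilleForm (m.incl x)]
  exact diffForm_extDeriv_pullback _ m.contMDiff_incl
    liouvilleForm.differentiable x

theorem extDeriv_contactForm_apply (x : m.Hypersurface) (v w : TangentSpace model x) :
    m.contactForm.extDeriv x ![v, w] = canonicalPairing (m.dincl x v) (m.dincl x w) := by
  rw [extDeriv_contactForm, ← canonicalTwoForm_apply]
  refine congrArg canonicalTwoForm ?_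
  ext i : 1
  fin_cases i <;> rfl

theorem contactForm_apply (x : m.Hypersurface) (v : E3 × EuclideanSpace ℝ (Fin 2)) :
    m.contactForm x ![v] = inner ℝ (m.incl x).2 (m.dincl x v).1 := rfl

/-- The vector `½ ∇(n²)`. -/
noncomputable def force (q : E3) : E3 := m.n q • gradient m.n q

theorem contDiff_force : ContDiff ℝ ∞ m.force := by
  refine m.smooth.smul ?_
  have : ContDiff ℝ ∞ (fderiv ℝ m.n) := m.smooth.fderiv_right (m := ∞) le_rfl
  exact (InnerProductSpace.toDual ℝ E3).symm.contDiff.comp this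

/-- The derivative of the Hamiltonian. -/
theorem hasFDerivAt_hamiltonian (x : CotangentE3) : ∃ D : CotangentE3 →L[ℝ] ℝ,
    HasFDerivAt m.hamiltonian D x ∧
    ∀ v, D v = 2 * (inner ℝ x.2 v.2 - inner ℝ (m.force x.1) v.1) := by
  have h1 : HasFDerivAt m.n (fderiv ℝ m.n x.1) x.1 :=
    (m.smooth.differentiable (by simp)).differentiableAt.hasFDerivAt
  have h2 := h1.comp x (hasFDerivAt_fst (𝕜 := ℝ) (p := x))
  have h3 := (hasFDerivAt_snd (𝕜 := ℝ) (p := x)).norm_sq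
  refine ⟨_, h3.sub (h2.pow 2), fun v => ?_⟩
  have h4 : inner ℝ (gradient m.n x.1) v.1 = fderiv ℝ m.n x.1 v.1 := by
    simp [gradient]
  simp [force, inner_smul_left, h4]
  ring

/-- The tangent space of `Σ` is the kernel of the derivative of the Hamiltonian. -/
theorem range_dincl (x : m.Hypersurface) (v : CotangentE3) :
    (∃ u, m.dincl x u = v) ↔
      inner ℝ (m.incl x).2 v.2 = inner ℝ (m.force (m.incl x).1) v.1 := by
  obtain ⟨D, hD, hDv⟩ := m.hasFDerivAt_hamiltonian (m.incl x)
  let A : (E3 × EuclideanSpace ℝ (Fin 2)) →L[ℝ] CotangentE3 :=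
    m.dincl x
  have hA : Function.Injective A := m.dincl_injective x
  have hle : A.toLinearMap.range ≤ D.toLinearMap.ker := by
    rintro _ ⟨u, rfl⟩
    have h1 : HasMFDerivAt model 𝓘(ℝ, ℝ) (m.hamiltonian ∘ m.incl) x (D.comp A) :=
      hD.hasMFDerivAt.comp x (m.contMDiff_incl.mdifferentiableAt (by simp)).hasMFDerivAt
    have h2 : m.hamiltonian ∘ m.incl = fun _ => (0 : ℝ) := funext fun y => y.2
    rw [h2] at h1
    have := hasMFDerivAt_unique h1 (hasMFDerivAt_const (0 : ℝ) x)
    exact DFunLike.congr_fun this u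
  -- At `(0, p)` the value of `D` is `2‖p‖² = 2n² > 0`. Hence `ker D` has dimension 5, the dimension
  -- of `Σ`, and the inclusion `hle` is an equality.
  have hp : D.toLinearMap ≠ 0 := by
    intro h
    have h1 := LinearMap.congr_fun h ((0, (m.incl x).2) : CotangentE3)
    have h2 := hDv (0, (m.incl x).2)
    have h3 := m.pos (m.incl x).1
    rw [← m.norm_snd x] at h3
    simp only [ContinuousLinearMap.coe_coe, LinearMap.zero_apply] at h1
    rw [h1] at h2
    simp at h2
    simp [h2] at h3
  have hdim : A.toLinearMap.range = D.toLinearMap.ker := by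
    apply Submodule.eq_of_le_of_finrank_le hle
    have h1 := LinearMap.finrank_range_of_inj (f := A.toLinearMap) hA
    have h2 := Module.Dual.finrank_ker_add_one_of_ne_zero hp
    simp at h1 h2
    omega
  have h1 : v ∈ A.toLinearMap.range ↔ v ∈ D.toLinearMap.ker := by rw [hdim]
  rw [LinearMap.mem_ker, ContinuousLinearMap.coe_coe, hDv] at h1
  constructor
  · intro h
    have := h1.1 h
    linarith
  · intro h
    exact h1.2 (by linarith)

/-- The Hamiltonian vector field, scaled to the Reeb vector field. -/
noncomputable def ambientReeb (x : CotangentE3) : CotangentE3 :=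
  ((m.n x.1) ^ 2)⁻¹ • (x.2, m.force x.1)

theorem contDiff_ambientReeb : ContDiff ℝ ∞ m.ambientReeb :=
  (((m.smooth.comp contDiff_fst).pow 2).inv fun _ => (pow_pos (m.pos _) 2).ne').smul
    (contDiff_snd.prodMk (m.contDiff_force.comp contDiff_fst))

/-- The symplectic complement of the hyperplane `ker dH` is a line. Two families of tangent test
vectors determine `v.1` and `v.2` with a common factor. -/
theorem exists_eq_smul_of_canonicalPairing_eq_zero (x : m.Hypersurface) (v : CotangentE3)
    (h : ∀ w : CotangentE3, inner ℝ (m.incl x).2 w.2 = inner ℝ (m.force (m.incl x).1) w.1 →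
      canonicalPairing v w = 0) :
    ∃ c : ℝ, v = c • m.ambientReeb (m.incl x) := by
  set p := (m.incl x).2
  set q := (m.incl x).1
  have hn : 0 < m.n q := m.pos q
  have hp : ‖p‖ = m.n q := m.norm_snd x
  have hpp : inner ℝ p p = m.n q ^ 2 := by rw [real_inner_self_eq_norm_sq, hp]
  have hpair : ∀ w : CotangentE3, canonicalPairing v w = inner ℝ v.2 w.1 - inner ℝ w.2 v.1 :=
    fun w => by rw [canonicalPairing_apply]
  have hne : m.n q ≠ 0 := hn.ne'
  -- The coefficient of the orthogonal projection of `v.1` to `p`; thus `v.1 - t • p` is orthogonal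
  -- to `p` and `(0, v.1 - t • p)` is tangent.
  set t : ℝ := inner ℝ p v.1 / m.n q ^ 2 with ht
  have ht' : inner ℝ p v.1 = t * m.n q ^ 2 := by rw [ht]; field_simp
  have h1 : v.1 = t • p := by
    rw [← sub_eq_zero, ← inner_self_eq_zero (𝕜 := ℝ)]
    have h2 := h (0, v.1 - t • p) (by
      simp only [inner_sub_right, inner_smul_right, inner_zero_right]
      rw [hpp, ht']; ring)
    rw [hpair] at h2
    simp only [inner_zero_right, zero_sub, neg_eq_zero] at h2
    have h3 : inner ℝ (v.1 - t • p) p = 0 := by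
      rw [inner_sub_left, inner_smul_left, hpp, real_inner_comm, ht']; simp
    rw [inner_sub_right, inner_smul_right, h3, h2]; simp
  have h2 : v.2 = t • m.force q := by
    refine ext_inner_right ℝ fun a => ?_
    -- For arbitrary `a`, this multiple of `p` is the one that makes the pair tangent.
    have h3 := h (a, ((m.n q ^ 2)⁻¹ * inner ℝ (m.force q) a) • p) (by
      simp only [inner_smul_right]
      rw [hpp]; field_simp)
    rw [hpair] at h3
    simp only [inner_smul_left, RCLike.conj_to_real] at h3 ⊢
    rw [ht'] at h3
    field_simp at h3
    linarith
  refine ⟨t * m.n q ^ 2, ?_⟩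
  unfold ambientReeb
  rw [smul_smul, mul_assoc, mul_inv_cancel₀ (by positivity), mul_one]
  exact Prod.ext h1 h2

theorem exists_dincl_eq_ambientReeb (x : m.Hypersurface) :
    ∃ u, m.dincl x u = m.ambientReeb (m.incl x) := by
  rw [m.range_dincl]
  simp only [ambientReeb, Prod.smul_fst, Prod.smul_snd, inner_smul_right]
  rw [real_inner_comm]

/-- The equation `ι_v dα = 0` fixes the direction of `v`, and `α(v) = 1` fixes the factor because
`θ` takes the value `‖p‖² / n² = 1` on `ambientReeb`. Conversely, contracting `dθ` with
`ambientReeb` gives a multiple of `dH`, which vanishes on tangent vectors. -/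
theorem isReebVector_iff (x : m.Hypersurface) (v : E3 × EuclideanSpace ℝ (Fin 2)) :
    m.contactForm.IsReebVector x v ↔
      m.dincl x v = m.ambientReeb (m.incl x) := by
  have hn : 0 < m.n (m.incl x).1 := m.pos _
  have hp : inner ℝ (m.incl x).2 (m.incl x).2 = m.n (m.incl x).1 ^ 2 := by
    rw [real_inner_self_eq_norm_sq, m.norm_snd]
  have hc : ∀ c : ℝ, inner ℝ (m.incl x).2 (c • m.ambientReeb (m.incl x)).1 = c := fun c => by
    simp only [ambientReeb, Prod.smul_fst, inner_smul_right, hp]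
    field_simp
  constructor
  · rintro ⟨h1, h2⟩
    obtain ⟨c, hcv⟩ := m.exists_eq_smul_of_canonicalPairing_eq_zero x
      (m.dincl x v) fun w hw => by
        obtain ⟨u, rfl⟩ := (m.range_dincl x w).2 hw
        exact (m.extDeriv_contactForm_apply x v u).symm.trans (h2 u)
    rw [contactForm_apply] at h1
    rw [hcv, hc] at h1
    rw [hcv, h1, one_smul]
  · intro h
    refine ⟨?_, fun w => ?_⟩
    · rw [contactForm_apply]
      rw [h]
      simpa using hc 1
    · refine (m.extDeriv_contactForm_apply x v w).trans ?_
      have hw := (m.range_dincl x _).1 ⟨w, rfl⟩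
      rw [h]
      rw [canonicalPairing_apply]
      simp only [ambientReeb, Prod.smul_fst, Prod.smul_snd, inner_smul_right, inner_smul_left,
        RCLike.conj_to_real]
      rw [← hw, real_inner_comm]
      ring

theorem existsUnique_isReebVector (x : m.Hypersurface) :
    ∃! v, m.contactForm.IsReebVector x v := by
  obtain ⟨u, hu⟩ := m.exists_dincl_eq_ambientReeb x
  exact ⟨u, (m.isReebVector_iff x u).2 hu, fun w hw =>
    m.dincl_injective x (((m.isReebVector_iff x w).1 hw).trans hu.symm)⟩

/-- The Reeb field, with values in the model space. -/
noncomputable def reeb (x : m.Hypersurface) : E3 × EuclideanSpace ℝ (Fin 2) :=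
  m.contactForm.reebField x

theorem isReebVector_reeb (x : m.Hypersurface) :
    m.contactForm.IsReebVector x (m.reeb x) :=
  Classical.epsilon_spec (m.existsUnique_isReebVector x).exists

theorem dincl_reeb (x : m.Hypersurface) :
    m.dincl x (m.reeb x) =
      m.ambientReeb (m.incl x) :=
  (m.isReebVector_iff x _).1 (m.isReebVector_reeb x)

theorem reeb_ne_zero (x : m.Hypersurface) : m.reeb x ≠ 0 := by
  intro h
  have h1 : inner ℝ (m.incl x).2 (m.dincl x (m.reeb x)).1 = 1 := (m.isReebVector_reeb x).1
  rw [h, map_zero] at h1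
  simp at h1

theorem exists_eq_smul_reeb (x : m.Hypersurface) (v : E3 × EuclideanSpace ℝ (Fin 2))
    (h : ∀ w : E3 × EuclideanSpace ℝ (Fin 2), canonicalPairing (m.dincl x v) (m.dincl x w) = 0) :
    ∃ c : ℝ, v = c • m.reeb x := by
  obtain ⟨c, hcv⟩ := m.exists_eq_smul_of_canonicalPairing_eq_zero x
    (m.dincl x v) fun w hw => by
      obtain ⟨u, rfl⟩ := (m.range_dincl x w).2 hw
      exact h u
  refine ⟨c, m.dincl_injective x ?_⟩
  rw [map_smul, dincl_reeb]
  exact hcv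

end OpticalMedium

/-! ### Smoothness of a vector field seen through an immersion. -/

section VectorField

variable {E : Type*} [NormedAddCommGroup E] [NormedSpace ℝ E] [FiniteDimensional ℝ E]
  {H : Type*} [TopologicalSpace H] {I : ModelWithCorners ℝ E H}
  {M : Type*} [TopologicalSpace M] [ChartedSpace H M] [IsManifold I 1 M]
  {F : Type*} [NormedAddCommGroup F] [NormedSpace ℝ F] [FiniteDimensional ℝ F]

/-- A vector field whose image under an immersion into a vector space is smooth is smooth. -/
theorem contMDiff_vectorField_of_immersion {f : M → F} {V : M → F}
    {v : ∀ x : M, TangentSpace I x}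
    (hf : ContMDiff I 𝓘(ℝ, F) ∞ f) (hV : ContMDiff I 𝓘(ℝ, F) ∞ V)
    (hinj : ∀ x, Function.Injective (mfderiv I 𝓘(ℝ, F) f x))
    (hv : ∀ x, mfderiv I 𝓘(ℝ, F) f x (v x) = V x) :
    ContMDiff I I.tangent ∞ (fun x => (⟨x, v x⟩ : TangentBundle I M)) := by
  intro x₀
  refine (Bundle.contMDiffAt_section x₀).2 ?_
  let df : M → E →L[ℝ] F := fun x => mfderiv I 𝓘(ℝ, F) f x
  set A : M → E →L[ℝ] F := inTangentCoordinates I 𝓘(ℝ, F) id f df x₀ with hA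
  have hAs : ContMDiffAt I 𝓘(ℝ, E →L[ℝ] F) ∞ A x₀ :=
    (hf x₀).mfderiv_const le_rfl
  set u : M → E := fun x => (trivializationAt E (TangentSpace I) x₀
    (⟨x, v x⟩ : TangentBundle I M)).2 with hu
  have hAu : ∀ᶠ x in 𝓝 x₀, A x (u x) = V x := by
    filter_upwards [(chartAt H x₀).open_source.mem_nhds (mem_chart_source H x₀)] with x hx
    have h1 : (tangentBundleCore I M).coordChange (achart H x₀) (achart H x) x (u x) = v x := by
      have := (tangentBundleCore I M).coordChange_comp (achart H x) (achart H x₀) (achart H x) x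
        ⟨⟨mem_achart_source H x, hx⟩, mem_achart_source H x⟩ (v x)
      exact this.trans ((tangentBundleCore I M).coordChange_self _ _ (mem_achart_source H x) _)
    rw [← hv x, hA, inTangentCoordinates_eq (I := I) (I' := 𝓘(ℝ, F)) id f df
      (x₀ := x₀) (x := x) hx (Set.mem_univ _)]
    simp only [ContinuousLinearMap.comp_apply, id]
    rw [h1]
    simp
    rfl
  have hA0 : Function.Injective (A x₀) := by
    rw [hA, inTangentCoordinates_eq (I := I) (I' := 𝓘(ℝ, F)) id f df (mem_chart_source H x₀)
      (by simp)]
    intro a b hab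
    simp only [ContinuousLinearMap.comp_apply, id, tangentBundleCore_coordChange_model_space,
      ContinuousLinearMap.coe_id'] at hab
    rw [(tangentBundleCore I M).coordChange_self _ _ (mem_achart_source H x₀),
      (tangentBundleCore I M).coordChange_self _ _ (mem_achart_source H x₀)] at hab
    exact hinj x₀ hab
  -- In the trivialisation around `x₀` the field `u` solves `A x (u x) = V x`. As `L ∘ A x` is the
  -- identity at `x₀`, it is invertible nearby, and `u = (L ∘ A)⁻¹ (L V)` is smooth.
  obtain ⟨L, hL⟩ := (A x₀).toLinearMap.exists_leftInverse_of_injective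
    (LinearMap.ker_eq_bot.2 hA0)
  let L' : F →L[ℝ] E := LinearMap.toContinuousLinearMap L
  have hLA : L'.comp (A x₀) = ContinuousLinearMap.id ℝ E :=
    ContinuousLinearMap.ext fun a => LinearMap.congr_fun hL a
  have hB : ContMDiffAt I 𝓘(ℝ, E →L[ℝ] E) ∞ (fun x => L'.comp (A x)) x₀ :=
    ContMDiffAt.clm_comp contMDiffAt_const hAs
  have hBinv : ContMDiffAt I 𝓘(ℝ, E →L[ℝ] E) ∞ (fun x => (L'.comp (A x)).inverse) x₀ := by
    have h1 : ContDiffAt ℝ ∞ (ContinuousLinearMap.inverse : (E →L[ℝ] E) → E →L[ℝ] E)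
        (L'.comp (A x₀)) := by
      rw [hLA]
      exact contDiffAt_map_inverse (ContinuousLinearEquiv.refl ℝ E)
    exact h1.contMDiffAt.comp x₀ hB
  have hinvt : ∀ᶠ x in 𝓝 x₀, (L'.comp (A x)).IsInvertible := by
    have h1 : {B : E →L[ℝ] E | B.IsInvertible} ∈ 𝓝 (L'.comp (A x₀)) := by
      rw [hLA]
      exact ContinuousLinearEquiv.nhds (ContinuousLinearEquiv.refl ℝ E)
    exact hB.continuousAt h1
  refine (hBinv.clm_apply (contMDiffAt_const (c := L') |>.clm_apply (hV x₀))).congr_of_eventuallyEq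
    ?_
  filter_upwards [hAu, hinvt] with x hx hi
  rw [← hx]
  exact (hi.inverse_apply_eq.2 rfl).symm

end VectorField

/-! ### Integral curves of the Reeb field and maps constant on orbits. -/

section Orbits

variable {E : Type*} [NormedAddCommGroup E] [NormedSpace ℝ E] [CompleteSpace E]
  {H : Type*} [TopologicalSpace H] {I : ModelWithCorners ℝ E H} [I.Boundaryless]
  {M : Type*} [TopologicalSpace M] [ChartedSpace H M] [IsManifold I 1 M]

/-- Lying on the same Reeb orbit is an equivalence relation if the Reeb field is `C¹`. -/
theorem DiffForm.equivalence_sameReebOrbit [T2Space M] (α : DiffForm I M 1)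
    (hα : ContMDiff I I.tangent 1 (fun x => (⟨x, α.reebField x⟩ : TangentBundle I M))) :
    Equivalence α.SameReebOrbit where
  refl x := by
    obtain ⟨γ, h0, hγ⟩ := exists_isMIntegralCurveAt_of_contMDiffAt_boundaryless 0 (hα x)
    obtain ⟨ε, hε, h⟩ := isMIntegralCurveAt_iff'.1 hγ
    rw [Real.ball_eq_Ioo] at h
    exact ⟨γ, _, _, 0, 0, h, by simpa using hε, by simpa using hε, h0, h0⟩
  symm := fun ⟨γ, a, b, s, t, h, hs, ht, h1, h2⟩ => ⟨γ, a, b, t, s, h, ht, hs, h2, h1⟩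
  trans := by
    rintro x y z ⟨γ, a, b, s, t, h, hs, ht, rfl, rfl⟩ ⟨γ', a', b', s', t', h', hs', ht', h1, rfl⟩
    -- The shift makes both curves pass through the common point at time `t`. By uniqueness they
    -- agree on the overlap of their intervals, so they glue.
    have h2 := h'.comp_add (s' - t)
    have h3 : {r | r + (s' - t) ∈ Set.Ioo a' b'} = Set.Ioo (a' - (s' - t)) (b' - (s' - t)) := by
      ext r
      simp [sub_lt_iff_lt_add, lt_sub_iff_add_lt]
    rw [h3] at h2
    have ht2 : t ∈ Set.Ioo (a' - (s' - t)) (b' - (s' - t)) := by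
      rw [← h3]; simpa using hs'
    have hγt : γ t = (γ' ∘ (· + (s' - t))) t := by simp [h1]
    have ht3 : t' - (s' - t) ∈ Set.Ioo (a' - (s' - t)) (b' - (s' - t)) := by
      rw [← h3]; simpa using ht'
    have h4 := isMIntegralCurveOn_piecewise hα h h2 ⟨ht, ht2⟩ hγt
    have h5 := eqOn_piecewise_of_isMIntegralCurveOn_Ioo hα h h2 ⟨ht, ht2⟩ hγt
    have h6 : Set.Ioo a b ∪ Set.Ioo (a' - (s' - t)) (b' - (s' - t)) =
        Set.Ioo (min a (a' - (s' - t))) (max b (b' - (s' - t))) :=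
      Set.Ioo_union_Ioo' (ht2.1.trans ht.2) (ht.1.trans ht2.2)
    refine ⟨_, _, _, s, t' - (s' - t), h6 ▸ h4, h6 ▸ Or.inl hs, h6 ▸ Or.inr ht3, ?_, ?_⟩
    · exact Set.piecewise_eq_of_mem _ _ _ hs
    · rw [h5 ht3]; simp

/-- The velocity of a Reeb orbit is annihilated by the differential of every map which is
constant on Reeb orbits near the point. -/
theorem DiffForm.mfderiv_reebField_eq_zero (α : DiffForm I M 1)
    (hα : ContMDiff I I.tangent 1 (fun x => (⟨x, α.reebField x⟩ : TangentBundle I M)))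
    {E' : Type*} [NormedAddCommGroup E'] [NormedSpace ℝ E']
    {H' : Type*} [TopologicalSpace H'] {J : ModelWithCorners ℝ E' H'}
    {N : Type*} [TopologicalSpace N] [ChartedSpace H' N]
    {f : M → N} {x : M} (hf : MDifferentiableAt I J f x)
    (hc : ∀ᶠ y in 𝓝 x, α.SameReebOrbit x y → f y = f x) :
    mfderiv I J f x (α.reebField x) = 0 := by
  obtain ⟨γ, h0, hγ⟩ := exists_isMIntegralCurveAt_of_contMDiffAt_boundaryless 0 (hα x)
  have hd := hγ.hasMFDerivAt
  obtain ⟨ε, hε, h⟩ := isMIntegralCurveAt_iff'.1 hγ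
  rw [Real.ball_eq_Ioo] at h
  have hmem : (0 : ℝ) ∈ Set.Ioo (0 - ε) (0 + ε) := by simpa using hε
  have hev : ∀ᶠ t in 𝓝 (0 : ℝ), f (γ t) = f x := by
    have hcont := hd.continuousAt
    rw [ContinuousAt, h0] at hcont
    filter_upwards [hcont.eventually hc, isOpen_Ioo.mem_nhds hmem] with t ht ht'
    exact ht ⟨γ, _, _, 0, t, h, hmem, ht', h0, rfl⟩
  subst h0
  have h1 := hf.hasMFDerivAt.comp 0 hd
  have h2 : f ∘ γ =ᶠ[𝓝 0] fun _ => f (γ 0) := hev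
  have h3 := hasMFDerivAt_unique h1
    ((hasMFDerivAt_const (I := 𝓘(ℝ, ℝ)) (I' := J) (f (γ 0)) (0 : ℝ)).congr_of_eventuallyEq h2)
  have h4 := DFunLike.congr_fun h3 (1 : ℝ)
  exact (congrArg (mfderiv I J f (γ 0)) (one_smul ℝ (α.reebField (γ 0))).symm).trans h4

end Orbits

namespace OpticalMedium

variable (m : OpticalMedium)

instance : T2Space m.Hypersurface :=
  inferInstanceAs (T2Space {x : CotangentE3 // m.hamiltonian x = 0})

instance : SecondCountableTopology m.Hypersurface :=
  inferInstanceAs (SecondCountableTopology {x : CotangentE3 // m.hamiltonian x = 0})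

/-- The choice by `Classical.epsilon` carries no regularity; smoothness comes from `ambientReeb`,
the image of the Reeb field under the immersion `incl`. -/
theorem contMDiff_reebField : ContMDiff model model.tangent ∞
    (fun x => (⟨x, m.contactForm.reebField x⟩ : TangentBundle model m.Hypersurface)) :=
  contMDiff_vectorField_of_immersion (v := m.reeb) m.contMDiff_incl
    (m.contDiff_ambientReeb.contMDiff.comp m.contMDiff_incl) m.dincl_injective m.dincl_reeb

theorem contMDiff_one_reebField : ContMDiff model model.tangent 1
    (fun x => (⟨x, m.contactForm.reebField x⟩ : TangentBundle model m.Hypersurface)) :=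
  m.contMDiff_reebField.of_le (WithTop.coe_le_coe.2 le_top)

theorem equivalence_sameReebOrbit : Equivalence m.contactForm.SameReebOrbit :=
  m.contactForm.equivalence_sameReebOrbit m.contMDiff_one_reebField

/-- The kernel of the differential of a submersion to a 4-dimensional manifold which is constant
on Reeb orbits is spanned by the Reeb field. -/
theorem exists_eq_smul_reeb_of_mem_ker {H' : Type*} [TopologicalSpace H']
    {J : ModelWithCorners ℝ (EuclideanSpace ℝ (Fin 4)) H'}
    {N : Type*} [TopologicalSpace N] [ChartedSpace H' N] {f : m.Hypersurface → N}
    {x : m.Hypersurface} (hf : MDifferentiableAt model J f x)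
    (hs : Function.Surjective (mfderiv model J f x))
    (hc : ∀ᶠ y in 𝓝 x, m.contactForm.SameReebOrbit x y → f y = f x)
    {v : E3 × EuclideanSpace ℝ (Fin 2)} (hv : mfderiv model J f x v = 0) :
    ∃ c : ℝ, v = c • m.reeb x := by
  let A : (E3 × EuclideanSpace ℝ (Fin 2)) →L[ℝ] EuclideanSpace ℝ (Fin 4) := mfderiv model J f x
  have hA : A.toLinearMap.range = ⊤ := LinearMap.range_eq_top.2 hs
  have hdim := A.toLinearMap.finrank_range_add_finrank_ker
  rw [hA] at hdim
  simp at hdim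
  -- The kernel has dimension `5 - 4 = 1` and contains the nonzero Reeb vector.
  have hR : m.reeb x ∈ A.toLinearMap.ker :=
    m.contactForm.mfderiv_reebField_eq_zero m.contMDiff_one_reebField hf hc
  have h1 : Module.finrank ℝ A.toLinearMap.ker = 1 := by omega
  obtain ⟨c, hc⟩ := (finrank_eq_one_iff_of_nonzero' (⟨m.reeb x, hR⟩ : A.toLinearMap.ker)
    (fun h => m.reeb_ne_zero x (congrArg Subtype.val h))).1 h1 ⟨v, hv⟩
  exact ⟨c, (congrArg Subtype.val hc).symm⟩

theorem canonicalPairing_reeb (x : m.Hypersurface) (w : E3 × EuclideanSpace ℝ (Fin 2)) :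
    canonicalPairing (m.dincl x (m.reeb x)) (m.dincl x w) = 0 :=
  (m.extDeriv_contactForm_apply x (m.reeb x) w).symm.trans ((m.isReebVector_reeb x).2 w)

end OpticalMedium

/-! ### Local form of submersions and local sections. -/

section Straightening

variable {E : Type*} [NormedAddCommGroup E] [NormedSpace ℝ E] [FiniteDimensional ℝ E]
  {F : Type*} [NormedAddCommGroup F] [NormedSpace ℝ F]

/-- A submersion between vector spaces is locally the projection of a product. -/
theorem exists_straightening {f : E → F} {s : Set E} {x₀ : E} (hs : IsOpen s) (hx₀ : x₀ ∈ s)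
    (hf : ContDiffOn ℝ ∞ f s) (hsurj : Function.Surjective (fderiv ℝ f x₀)) :
    ∃ (K : Submodule ℝ E) (P : OpenPartialHomeomorph E (F × K)), x₀ ∈ P.source ∧ P.source ⊆ s ∧
      ContDiffOn ℝ ∞ P P.source ∧ ContDiffOn ℝ ∞ P.symm P.target ∧
      ∀ x ∈ P.source, (P x).1 = f x := by
  have h0 : (∞ : WithTop ℕ∞) ≠ 0 := by simp
  set D := fderiv ℝ f x₀
  set K := D.toLinearMap.ker
  obtain ⟨C, hC⟩ := K.exists_isCompl
  -- Completing `f` by a projection to the kernel of its derivative makes the derivative at `x₀`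
  -- bijective, as the inverse function theorem requires.
  let p : E →L[ℝ] K := LinearMap.toContinuousLinearMap (K.projectionOnto C hC)
  have hp : ∀ k : K, p k = k := fun k => Submodule.projectionOnto_apply_left hC k
  let e₀ : E →ₗ[ℝ] F × K := (D.prod p).toLinearMap
  have hinj : Function.Injective e₀ := by
    rw [← LinearMap.ker_eq_bot, LinearMap.ker_eq_bot']
    intro v hv
    have h1 : D v = 0 := congrArg Prod.fst hv
    have h2 : p v = 0 := congrArg Prod.snd hv
    have h3 := hp ⟨v, h1⟩
    exact congrArg Subtype.val (h3.symm.trans h2)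
  have hsur : Function.Surjective e₀ := by
    rintro ⟨a, k⟩
    obtain ⟨v, rfl⟩ := hsurj a
    refine ⟨v + (k - p v : K), Prod.ext ?_ ?_⟩
    · have : D ((k - p v : K) : E) = 0 := (k - p v : K).2
      change D (v + _) = D v
      rw [map_add, this, add_zero]
    · change p (v + _) = k
      rw [map_add, hp]; simp
  let e : E ≃L[ℝ] F × K :=
    (LinearEquiv.ofBijective e₀ ⟨hinj, hsur⟩).toContinuousLinearEquiv
  have he : (e : E →L[ℝ] F × K) = D.prod p := rfl
  let Φ : E → F × K := fun x => (f x, p x)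
  have hΦ : ContDiffOn ℝ ∞ Φ s := hf.prodMk p.contDiff.contDiffOn
  have hΦat : ∀ x ∈ s, ContDiffAt ℝ ∞ Φ x := fun x hx => hΦ.contDiffAt (hs.mem_nhds hx)
  have hΦ' : ContDiffOn ℝ ∞ (fderiv ℝ Φ) s := hΦ.fderiv_of_isOpen hs le_rfl
  have hder : fderiv ℝ Φ x₀ = e := by
    rw [he]
    exact ((((hf.contDiffAt (hs.mem_nhds hx₀)).differentiableAt h0).hasFDerivAt).prodMk
      p.hasFDerivAt).fderiv
  have hstrict : HasStrictFDerivAt Φ (e : E →L[ℝ] F × K) x₀ := by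
    rw [← hder]
    exact (hΦat x₀ hx₀).hasStrictFDerivAt h0
  let P₀ := hstrict.toOpenPartialHomeomorph Φ
  have hP₀ : (P₀ : E → F × K) = Φ := hstrict.toOpenPartialHomeomorph_coe
  have hx₀P : x₀ ∈ P₀.source := hstrict.mem_toOpenPartialHomeomorph_source
  -- Shrinking to the points with invertible derivative makes the inverse smooth on the whole
  -- target.
  have hO : IsOpen (s ∩ fderiv ℝ Φ ⁻¹' Set.range ((↑) : (E ≃L[ℝ] F × K) → E →L[ℝ] F × K)) :=
    hΦ'.continuousOn.isOpen_inter_preimage hs ContinuousLinearEquiv.isOpen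
  have hxO : x₀ ∈ s ∩ fderiv ℝ Φ ⁻¹' Set.range ((↑) : (E ≃L[ℝ] F × K) → E →L[ℝ] F × K) :=
    ⟨hx₀, e, hder.symm⟩
  let P := P₀.restrOpen _ hO
  have hPc : (P : E → F × K) = Φ := hP₀
  have hsrc : P.source ⊆ s := fun x hx => hx.2.1
  refine ⟨K, P, ⟨hx₀P, hxO⟩, hsrc, ?_, ?_, ?_⟩
  · rw [hPc]; exact hΦ.mono hsrc
  · intro y hy
    have hy' := P.map_target hy
    obtain ⟨e', he'⟩ := hy'.2.2
    refine (P.contDiffAt_symm (f₀' := e') hy ?_ ?_).contDiffWithinAt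
    · rw [he', hPc]
      exact ((hΦat _ (hsrc hy')).differentiableAt h0).hasFDerivAt
    · rw [hPc]
      exact hΦat _ (hsrc hy')
  · intro x _
    rw [hPc]

variable {H : Type*} [TopologicalSpace H] {I : ModelWithCorners ℝ E H} [I.Boundaryless]
  {M : Type*} [TopologicalSpace M] [ChartedSpace H M] [IsManifold I ∞ M]

/-- A submersion of a manifold to a vector space is locally the projection of a product. -/
theorem exists_flowBox {f : M → F} {U : Set M} {x₀ : M} (hU : IsOpen U) (hx₀ : x₀ ∈ U)
    (hf : ContMDiffOn I 𝓘(ℝ, F) ∞ f U) (hsurj : Function.Surjective (mfderiv I 𝓘(ℝ, F) f x₀)) :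
    ∃ (K : Submodule ℝ E) (P : OpenPartialHomeomorph M (F × K)), x₀ ∈ P.source ∧ P.source ⊆ U ∧
      ContMDiffOn I 𝓘(ℝ, F × K) ∞ P P.source ∧ ContMDiffOn 𝓘(ℝ, F × K) I ∞ P.symm P.target ∧
      ∀ x ∈ P.source, (P x).1 = f x := by
  let φ : OpenPartialHomeomorph M E :=
    (chartAt H x₀).trans I.toHomeomorph.toOpenPartialHomeomorph
  have hφ : ContMDiffOn I 𝓘(ℝ, E) ∞ φ φ.source := by
    have := contMDiffOn_extChartAt (I := I) (n := ∞) (x := x₀)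
    exact this.mono fun x hx => hx.1
  have hφt : φ.target = (extChartAt I x₀).target := by
    simp [φ, extChartAt, OpenPartialHomeomorph.extend, I.range_eq_univ]
    rfl
  have hφs : ContMDiffOn 𝓘(ℝ, E) I ∞ φ.symm φ.target := by
    have := contMDiffOn_extChartAt_symm (I := I) (n := ∞) x₀
    rw [hφt]
    exact this
  have hxφ : x₀ ∈ φ.source := by simp [φ]
  have hs : IsOpen (φ.target ∩ φ.symm ⁻¹' U) := φ.isOpen_inter_preimage_symm hU
  have hfφ : ContDiffOn ℝ ∞ (f ∘ φ.symm) (φ.target ∩ φ.symm ⁻¹' U) :=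
    (hf.comp (hφs.mono Set.inter_subset_left) fun y hy => hy.2).contDiffOn
  have hmem : φ x₀ ∈ φ.target ∩ φ.symm ⁻¹' U :=
    ⟨φ.map_source hxφ, by rw [Set.mem_preimage, φ.left_inv hxφ]; exact hx₀⟩
  have hsurj' : Function.Surjective (fderiv ℝ (f ∘ φ.symm) (φ x₀)) := by
    have h0 : (∞ : WithTop ℕ∞) ≠ 0 := by simp
    have h1 : MDifferentiableAt 𝓘(ℝ, E) 𝓘(ℝ, F) (f ∘ φ.symm) (φ x₀) :=
      ((hfφ.contDiffAt (hs.mem_nhds hmem)).differentiableAt h0).mdifferentiableAt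
    have h2 : MDifferentiableAt I 𝓘(ℝ, E) φ x₀ :=
      (hφ.contMDiffAt (φ.open_source.mem_nhds hxφ)).mdifferentiableAt h0
    have h3 := mfderiv_comp x₀ h1 h2
    have h4 : f =ᶠ[𝓝 x₀] (f ∘ φ.symm) ∘ φ := by
      filter_upwards [φ.open_source.mem_nhds hxφ] with y hy
      exact congrArg f (φ.left_inv hy).symm
    have h5 := h4.mfderiv_eq.trans h3
    rw [mfderiv_eq_fderiv] at h5
    intro a
    obtain ⟨v, hv⟩ := hsurj a
    exact ⟨mfderiv I 𝓘(ℝ, E) φ x₀ v, (DFunLike.congr_fun h5 v).symm.trans hv⟩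
  obtain ⟨K, P, hxP, hPs, hP, hPsymm, hPf⟩ := exists_straightening hs hmem hfφ hsurj'
  have hsrc : ∀ x ∈ (φ.trans P).source, x ∈ φ.source ∧ φ x ∈ P.source := fun x hx => by
    simpa using hx
  refine ⟨K, φ.trans P, by simpa using ⟨hxφ, hxP⟩, ?_, ?_, ?_, ?_⟩
  · intro x hx
    obtain ⟨h1, h2⟩ := hsrc x hx
    have := (hPs h2).2
    rwa [Set.mem_preimage, φ.left_inv h1] at this
  · exact hP.contMDiffOn.comp (hφ.mono fun x hx => (hsrc x hx).1) fun x hx => (hsrc x hx).2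
  · have ht : ∀ y ∈ (φ.trans P).target, y ∈ P.target ∧ P.symm y ∈ φ.target := fun y hy => by
      simpa [OpenPartialHomeomorph.trans_target] using hy
    exact hφs.comp (hPsymm.contMDiffOn.mono fun y hy => (ht y hy).1) fun y hy => (ht y hy).2
  · intro x hx
    obtain ⟨h1, h2⟩ := hsrc x hx
    change (P (φ x)).1 = f x
    rw [hPf _ h2]
    exact congrArg f (φ.left_inv h1)

/-- A submersion has a smooth local section through every point. -/
theorem exists_localSection {f : M → F} {U : Set M} {x₀ : M} (hU : IsOpen U) (hx₀ : x₀ ∈ U)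
    (hf : ContMDiffOn I 𝓘(ℝ, F) ∞ f U) (hsurj : Function.Surjective (mfderiv I 𝓘(ℝ, F) f x₀)) :
    ∃ (σ : F → M) (V : Set F), IsOpen V ∧ f x₀ ∈ V ∧ ContMDiffOn 𝓘(ℝ, F) I ∞ σ V ∧
      σ (f x₀) = x₀ ∧ ∀ y ∈ V, σ y ∈ U ∧ f (σ y) = y := by
  obtain ⟨K, P, hx, hPU, -, hPs, hPf⟩ := exists_flowBox hU hx₀ hf hsurj
  have hc : Continuous fun y : F => (y, (P x₀).2) := by fun_prop
  have hP0 : (f x₀, (P x₀).2) = P x₀ := Prod.ext (hPf x₀ hx).symm rfl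
  refine ⟨fun y => P.symm (y, (P x₀).2), _, P.open_target.preimage hc, ?_, ?_, ?_, ?_⟩
  · rw [Set.mem_preimage, hP0]
    exact P.map_source hx
  · have h1 : ContMDiff 𝓘(ℝ, F) 𝓘(ℝ, F × K) ∞ (fun y : F => (y, (P x₀).2)) :=
      (contDiff_id.prodMk contDiff_const).contMDiff
    exact hPs.comp h1.contMDiffOn fun y hy => hy
  · change P.symm (f x₀, (P x₀).2) = x₀
    rw [hP0, P.left_inv hx]
  · intro y hy
    have h2 := P.map_target hy
    refine ⟨hPU h2, ?_⟩
    rw [← hPf _ h2, P.right_inv hy]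

end Straightening

/-! ### Invariance of a closed horizontal two-form along fibres. -/

section HorizontalForm

variable {V : Type*} [NormedAddCommGroup V] [NormedSpace ℝ V]
  {K : Type*} [NormedAddCommGroup K] [NormedSpace ℝ K]
  {W : Type*} [NormedAddCommGroup W] [NormedSpace ℝ W]

/-- The derivative of the coefficients of the pullback of a constant two-form. -/
theorem hasFDerivAt_pairing_fderiv (B : W →L[ℝ] W →L[ℝ] ℝ) {F : V → W} {y : V}
    (hF : ContDiffAt ℝ ∞ F y) (a b : V) :
    ∃ L : V →L[ℝ] ℝ, HasFDerivAt (fun z => B (fderiv ℝ F z a) (fderiv ℝ F z b)) L y ∧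
      ∀ c, L c = B (fderiv ℝ (fderiv ℝ F) y c a) (fderiv ℝ F y b) +
        B (fderiv ℝ F y a) (fderiv ℝ (fderiv ℝ F) y c b) := by
  have h1 : HasFDerivAt (fderiv ℝ F) (fderiv ℝ (fderiv ℝ F) y) y :=
    ((hF.fderiv_right (m := ∞) le_rfl).differentiableAt (by simp)).hasFDerivAt
  have h2 : ∀ a, HasFDerivAt (fun z => fderiv ℝ F z a) ((fderiv ℝ (fderiv ℝ F) y).flip a) y :=
    fun a => by simpa using! h1.clm_apply (hasFDerivAt_const a y)
  refine ⟨_, B.hasFDerivAt_of_bilinear (h2 a) (h2 b), fun c => ?_⟩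
  simp [add_comm]

/-- If the pullback of a constant two-form to a product annihilates the second factor, then
its coefficients are constant along that factor. -/
theorem pairing_fderiv_eq_of_horizontal (B : W →L[ℝ] W →L[ℝ] ℝ) (hB : ∀ v w, B v w = -B w v)
    {F : V × K → W} {v : V} {S : Set K} (hS : IsOpen S) (hSc : IsPreconnected S)
    (hF : ∀ s ∈ S, ContDiffAt ℝ ∞ F (v, s))
    (hor : ∀ s ∈ S, ∀ᶠ y in 𝓝 (v, s), ∀ k a, B (fderiv ℝ F y (0, k)) (fderiv ℝ F y a) = 0)
    {s t : K} (hs : s ∈ S) (ht : t ∈ S) (a b : V × K) :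
    B (fderiv ℝ F (v, s) a) (fderiv ℝ F (v, s) b) =
      B (fderiv ℝ F (v, t) a) (fderiv ℝ F (v, t) b) := by
  -- This is `L_R dα = 0` in coordinates: the horizontality identity is differentiated, and the
  -- symmetry of the second derivative of `F` plays the role of closedness.
  have key : ∀ s ∈ S, HasFDerivAt (fun s => B (fderiv ℝ F (v, s) a) (fderiv ℝ F (v, s) b))
      (0 : K →L[ℝ] ℝ) s := by
    intro s hs
    have hzero : ∀ k a c, B (fderiv ℝ (fderiv ℝ F) (v, s) c (0, k)) (fderiv ℝ F (v, s) a) +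
        B (fderiv ℝ F (v, s) (0, k)) (fderiv ℝ (fderiv ℝ F) (v, s) c a) = 0 := by
      intro k a c
      obtain ⟨L, hL, hLc⟩ := hasFDerivAt_pairing_fderiv B (hF s hs) (0, k) a
      rw [← hLc]
      have h0 : (fun z => B (fderiv ℝ F z (0, k)) (fderiv ℝ F z a)) =ᶠ[𝓝 (v, s)] fun _ => 0 := by
        filter_upwards [hor s hs] with y hy
        exact hy k a
      rw [(hL.congr_of_eventuallyEq h0.symm).unique (hasFDerivAt_const 0 _)]
      rfl
    obtain ⟨L, hL, hLc⟩ := hasFDerivAt_pairing_fderiv B (hF s hs) a b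
    have hsym : ∀ a b, fderiv ℝ (fderiv ℝ F) (v, s) a b = fderiv ℝ (fderiv ℝ F) (v, s) b a :=
      (hF s hs).isSymmSndFDerivAt (by
        rw [minSmoothness_of_isRCLikeNormedField]
        exact WithTop.coe_le_coe.2 le_top)
    have h1 : HasFDerivAt (fun s : K => (v, s)) (ContinuousLinearMap.inr ℝ V K) s :=
      hasFDerivAt_prodMk_right v s
    have h2 := hL.comp s h1
    have h3 : L.comp (ContinuousLinearMap.inr ℝ V K) = 0 := by
      ext k
      simp only [ContinuousLinearMap.comp_apply, ContinuousLinearMap.inr_apply, hLc,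
        zero_apply]
      -- The two terms of the derivative along `k` equal `∓ B (F' k) (F'' a b)` by `e1` and `e2`,
      -- and cancel.
      have e1 := hzero k b a
      have e2 := hzero k a b
      rw [hsym b a] at e2
      rw [hsym a] at e1
      rw [hsym b, hB _ (fderiv ℝ F (v, s) a)] at e2
      linarith
    rw [h3] at h2
    exact h2
  exact hS.is_const_of_fderiv_eq_zero hSc
    (fun s hs => (key s hs).differentiableAt.differentiableWithinAt)
    (fun s hs => (key s hs).fderiv) hs ht

end HorizontalForm

theorem canonicalPairing_antisymm (v w : CotangentE3) :
    canonicalPairing v w = -canonicalPairing w v := by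
  rw [canonicalPairing_apply, canonicalPairing_apply]
  ring

/-! ### Transport of `dα` along Reeb orbits by germs. -/

namespace OpticalMedium

variable (m : OpticalMedium)

/-- There is a germ of a smooth map taking `x` to `y`, preserving all Reeb orbits, and preserving
`dα` at `x`. -/
def OrbitGerm (x y : m.Hypersurface) : Prop :=
  ∃ (g : m.Hypersurface → m.Hypersurface)
    (D : E3 × EuclideanSpace ℝ (Fin 2) →L[ℝ] E3 × EuclideanSpace ℝ (Fin 2)),
    ContMDiffAt model model ∞ g x ∧ g x = y ∧
    (∀ᶠ w in 𝓝 x, m.contactForm.SameReebOrbit w (g w)) ∧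
    HasMFDerivAt model model g x D ∧
    ∀ v w, canonicalPairing (m.dincl y (D v)) (m.dincl y (D w)) =
      canonicalPairing (m.dincl x v) (m.dincl x w)

variable {m}

theorem OrbitGerm.trans {x y z : m.Hypersurface} (h : m.OrbitGerm x y) (h' : m.OrbitGerm y z) :
    m.OrbitGerm x z := by
  obtain ⟨g, D, hg, rfl, ho, hD, hp⟩ := h
  obtain ⟨g', D', hg', rfl, ho', hD', hp'⟩ := h'
  refine ⟨g' ∘ g, D'.comp D, hg'.comp x hg, rfl, ?_, hD'.comp x hD, fun v w => ?_⟩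
  · filter_upwards [ho, hg.continuousAt.eventually ho'] with w hw hw'
    exact m.equivalence_sameReebOrbit.trans hw hw'
  · exact (hp' (D v) (D w)).trans (hp v w)

variable (m)

/-- In a chart adapted to the Reeb orbits, the form `dα` annihilates the fibre direction. -/
theorem canonicalPairing_fderiv_flowBox {K : Submodule ℝ (E3 × EuclideanSpace ℝ (Fin 2))}
    {P : OpenPartialHomeomorph m.Hypersurface (EuclideanSpace ℝ (Fin 4) × K)}
    {f : m.Hypersurface → EuclideanSpace ℝ (Fin 4)} {U : Set m.Hypersurface} (hU : IsOpen U)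
    (hf : ContMDiffOn model (𝓡 4) ∞ f U)
    (hsurj : ∀ y ∈ U, Function.Surjective (mfderiv model (𝓡 4) f y))
    (hfib : ∀ y ∈ U, ∀ z ∈ U, (m.contactForm.SameReebOrbit y z ↔ f y = f z))
    (hPU : P.source ⊆ U)
    (hPs : ContMDiffOn 𝓘(ℝ, EuclideanSpace ℝ (Fin 4) × K) model ∞ P.symm P.target)
    (hPf : ∀ x ∈ P.source, (P x).1 = f x) {y : EuclideanSpace ℝ (Fin 4) × K} (hy : y ∈ P.target)
    (k : K) (a : EuclideanSpace ℝ (Fin 4) × K) :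
    canonicalPairing (fderiv ℝ (m.incl ∘ P.symm) y (0, k)) (fderiv ℝ (m.incl ∘ P.symm) y a) = 0 := by
  have h0 : (∞ : WithTop ℕ∞) ≠ 0 := by simp
  have hx := P.map_target hy
  set x := P.symm y with hxy
  have hS : MDifferentiableAt 𝓘(ℝ, EuclideanSpace ℝ (Fin 4) × K) model P.symm y :=
    (hPs.contMDiffAt (P.open_target.mem_nhds hy)).mdifferentiableAt h0
  let S : (EuclideanSpace ℝ (Fin 4) × K) →L[ℝ] E3 × EuclideanSpace ℝ (Fin 2) :=
    mfderiv 𝓘(ℝ, EuclideanSpace ℝ (Fin 4) × K) model P.symm y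
  have hF : fderiv ℝ (m.incl ∘ P.symm) y = (m.dincl x).comp S := by
    have := mfderiv_comp y (m.contMDiff_incl.mdifferentiableAt h0) hS
    rw [mfderiv_eq_fderiv] at this
    exact this
  have hfx : MDifferentiableAt model (𝓡 4) f x :=
    (hf.contMDiffAt (hU.mem_nhds (hPU hx))).mdifferentiableAt h0
  -- In the box `f` is the first projection, so fibre vectors lie in the kernel of `df`, which is
  -- the Reeb line.
  have hker : mfderiv model (𝓡 4) f x (S (0, k)) = 0 := by
    have h1 := mfderiv_comp y hfx hS
    have h2 : f ∘ P.symm =ᶠ[𝓝 y] Prod.fst := by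
      filter_upwards [P.open_target.mem_nhds hy] with z hz
      rw [Function.comp_apply, ← hPf _ (P.map_target hz), P.right_inv hz]
    have h3 := h2.mfderiv_eq.symm.trans h1
    rw [mfderiv_eq_fderiv, fderiv_fst] at h3
    exact (DFunLike.congr_fun h3 ((0, k) : EuclideanSpace ℝ (Fin 4) × K)).symm
  obtain ⟨c, hc⟩ := m.exists_eq_smul_reeb_of_mem_ker hfx (hsurj x (hPU hx)) (by
    filter_upwards [hU.mem_nhds (hPU hx)] with z hz h
    exact ((hfib x (hPU hx) z hz).1 h).symm) hker
  rw [hF, ContinuousLinearMap.comp_apply, ContinuousLinearMap.comp_apply, hc, map_smul, map_smul,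
    smul_apply, m.canonicalPairing_reeb, smul_zero]

/-- In a flow box the germ overwrites the fibre coordinate by that of `u'`. It is not a local
diffeomorphism, but it only loses the fibre direction, which `dα` annihilates, and the coefficients
of `dα` are constant along the fibre. Product balls are used so that each slice is connected. -/
theorem eventually_orbitGerm (hreg : m.contactForm.IsRegularReeb 4) (x₀ : m.Hypersurface) :
    ∃ W ∈ 𝓝 x₀, ∀ u ∈ W, ∀ u' ∈ W, m.contactForm.SameReebOrbit u u' → m.OrbitGerm u u' := by
  have h0 : (∞ : WithTop ℕ∞) ≠ 0 := by simp
  obtain ⟨U, hU, hxU, f, hf, hsurj, hfib⟩ := hreg x₀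
  obtain ⟨K, P, hxP, hPU, hP, hPs, hPf⟩ := exists_flowBox hU hxU hf (hsurj x₀ hxU)
  have hPx : P.target ∈ 𝓝 (P x₀) := P.open_target.mem_nhds (P.map_source hxP)
  obtain ⟨r, hr, hball⟩ := Metric.mem_nhds_iff.1 hPx
  rw [← ball_prod_same] at hball
  refine ⟨P.source ∩ P ⁻¹' (Metric.ball (P x₀).1 r ×ˢ Metric.ball (P x₀).2 r),
    (P.isOpen_inter_preimage (Metric.isOpen_ball.prod Metric.isOpen_ball)).mem_nhds
      ⟨hxP, Metric.mem_ball_self hr, Metric.mem_ball_self hr⟩, ?_⟩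
  rintro u ⟨hu, hub⟩ u' ⟨hu', hub'⟩ huu'
  have hfst : (P u).1 = (P u').1 := by
    rw [hPf _ hu, hPf _ hu']
    exact (hfib _ (hPU hu) _ (hPU hu')).1 huu'
  have hPu : ((P u).1, (P u').2) = P u' := by rw [hfst]
  let ι : EuclideanSpace ℝ (Fin 4) × K → EuclideanSpace ℝ (Fin 4) × K := fun y => (y.1, (P u').2)
  let j : EuclideanSpace ℝ (Fin 4) × K →L[ℝ] EuclideanSpace ℝ (Fin 4) × K :=
    (ContinuousLinearMap.fst ℝ _ _).prod 0
  have hι : ∀ y, HasFDerivAt ι j y := fun y =>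
    hasFDerivAt_fst.prodMk (hasFDerivAt_const _ _)
  have hPat : ContMDiffAt model 𝓘(ℝ, EuclideanSpace ℝ (Fin 4) × K) ∞ P u :=
    hP.contMDiffAt (P.open_source.mem_nhds hu)
  have hSat : ContMDiffAt 𝓘(ℝ, EuclideanSpace ℝ (Fin 4) × K) model ∞ P.symm (P u') :=
    hPs.contMDiffAt (P.open_target.mem_nhds (P.map_source hu'))
  have hιs : ContMDiff 𝓘(ℝ, EuclideanSpace ℝ (Fin 4) × K) 𝓘(ℝ, EuclideanSpace ℝ (Fin 4) × K) ∞ ι :=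
    (contDiff_fst.prodMk contDiff_const).contMDiff
  have hιu : ι (P u) = P u' := hPu
  let DP : (E3 × EuclideanSpace ℝ (Fin 2)) →L[ℝ] EuclideanSpace ℝ (Fin 4) × K :=
    mfderiv model 𝓘(ℝ, EuclideanSpace ℝ (Fin 4) × K) P u
  let DS : (EuclideanSpace ℝ (Fin 4) × K) →L[ℝ] E3 × EuclideanSpace ℝ (Fin 2) :=
    mfderiv 𝓘(ℝ, EuclideanSpace ℝ (Fin 4) × K) model P.symm (P u')
  have hDP : HasMFDerivAt model 𝓘(ℝ, EuclideanSpace ℝ (Fin 4) × K) P u DP :=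
    (hPat.mdifferentiableAt h0).hasMFDerivAt
  have hDS : HasMFDerivAt 𝓘(ℝ, EuclideanSpace ℝ (Fin 4) × K) model P.symm (ι (P u)) DS := by
    rw [hιu]
    exact (hSat.mdifferentiableAt h0).hasMFDerivAt
  have hSat' : ContMDiffAt 𝓘(ℝ, EuclideanSpace ℝ (Fin 4) × K) model ∞ P.symm (ι (P u)) := by
    rw [hιu]; exact hSat
  have hg : ContMDiffAt model model ∞ (P.symm ∘ ι ∘ P) u :=
    hSat'.comp u (hιs.contMDiffAt.comp u hPat)
  have hgu : (P.symm ∘ ι ∘ P) u = u' := by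
    rw [Function.comp_apply, Function.comp_apply, hιu, P.left_inv hu']
  refine ⟨P.symm ∘ ι ∘ P, DS.comp (j.comp DP), hg, hgu, ?_,
    hDS.comp u ((hι (P u)).hasMFDerivAt.comp u hDP), ?_⟩
  · have h1 : ContinuousAt (ι ∘ P) u := hιs.continuous.continuousAt.comp hPat.continuousAt
    have h2 : P.target ∈ 𝓝 ((ι ∘ P) u) := by
      rw [Function.comp_apply, hιu]
      exact P.open_target.mem_nhds (P.map_source hu')
    filter_upwards [P.open_source.mem_nhds hu, h1 h2] with w hw hw'
    have h3 := P.map_target hw'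
    refine (hfib _ (hPU hw) _ (hPU h3)).2 ?_
    rw [← hPf _ hw, ← hPf _ h3, P.right_inv hw']
    rfl
  · have hFat : ∀ y ∈ P.target, ContDiffAt ℝ ∞ (m.incl ∘ P.symm) y := fun y hy =>
      (m.contMDiff_incl.contMDiffAt.comp y
        (hPs.contMDiffAt (P.open_target.mem_nhds hy))).contDiffAt
    have hor : ∀ y ∈ P.target, ∀ k a, canonicalPairing (fderiv ℝ (m.incl ∘ P.symm) y (0, k))
        (fderiv ℝ (m.incl ∘ P.symm) y a) = 0 := fun y hy =>
      m.canonicalPairing_fderiv_flowBox hU hf hsurj hfib hPU hPs hPf hy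
    have hsub : ∀ s ∈ Metric.ball (P x₀).2 r, ((P u').1, s) ∈ P.target := fun s hs =>
      hball ⟨hub'.1, hs⟩
    have hconst := pairing_fderiv_eq_of_horizontal canonicalPairing canonicalPairing_antisymm
      (F := m.incl ∘ P.symm) (v := (P u').1) Metric.isOpen_ball
      (convex_ball (P x₀).2 r).isPreconnected (fun s hs => hFat _ (hsub s hs))
      (fun s hs => by
        filter_upwards [P.open_target.mem_nhds (hsub s hs)] with y hy
        exact hor y hy) hub.2 hub'.2
    have e1 : ((P u').1, (P u).2) = P u := by rw [← hfst]
    have e2 : ((P u').1, (P u').2) = P u' := rfl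
    rw [e1, e2] at hconst
    have hFu' : fderiv ℝ (m.incl ∘ P.symm) (P u') = (m.dincl u').comp DS := by
      have h1 := mfderiv_comp (P u') (m.contMDiff_incl.mdifferentiableAt h0)
        (hSat.mdifferentiableAt h0)
      rw [mfderiv_eq_fderiv, P.left_inv hu'] at h1
      exact h1
    have hFu : (fderiv ℝ (m.incl ∘ P.symm) (P u)).comp DP = m.dincl u := by
      have h1 := (((hFat _ (P.map_source hu)).differentiableAt h0).hasFDerivAt.hasMFDerivAt.comp u
        hDP).mfderiv
      have h2 : m.incl =ᶠ[𝓝 u] (m.incl ∘ P.symm) ∘ P := by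
        filter_upwards [P.open_source.mem_nhds hu] with w hw
        exact congrArg m.incl (P.left_inv hw).symm
      exact (h2.mfderiv_eq.trans h1).symm
    -- `j a` differs from `a` by the fibre vector `(0, a.2)`, which is in the kernel of the form.
    have hdrop : ∀ a b, canonicalPairing (fderiv ℝ (m.incl ∘ P.symm) (P u) (j a))
        (fderiv ℝ (m.incl ∘ P.symm) (P u) (j b)) =
        canonicalPairing (fderiv ℝ (m.incl ∘ P.symm) (P u) a)
          (fderiv ℝ (m.incl ∘ P.symm) (P u) b) := by
      intro a b
      have hj : ∀ a : EuclideanSpace ℝ (Fin 4) × K, j a = a - (0, a.2) := fun a =>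
        Prod.ext (by simp [j]) (by simp [j])
      have h1 := hor _ (P.map_source hu)
      rw [hj, hj, map_sub, map_sub, map_sub, sub_apply, map_sub, map_sub,
        h1, h1, canonicalPairing_antisymm _ (fderiv ℝ (m.incl ∘ P.symm) (P u) (0, b.2)), h1]
      simp
    intro v w
    rw [← hFu]
    have h3 : ∀ v, m.dincl u' ((DS.comp (j.comp DP)) v) =
        fderiv ℝ (m.incl ∘ P.symm) (P u') (j (DP v)) := fun v => by rw [hFu']; rfl
    rw [h3, h3, ← hconst, hdrop]
    rfl

/-- An orbit need not stay in one flow box; connectedness of the time interval chains the local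
germs. -/
theorem orbitGerm_of_sameReebOrbit (hreg : m.contactForm.IsRegularReeb 4) {x y : m.Hypersurface}
    (h : m.contactForm.SameReebOrbit x y) : m.OrbitGerm x y := by
  obtain ⟨γ, a, b, s, t, hγ, hs, ht, rfl, rfl⟩ := h
  refine (isPreconnected_Ioo.induction₂
    -- Both directions are carried along because the induction needs a symmetric relation and a germ
    -- need not be invertible.
    (fun s t => m.OrbitGerm (γ s) (γ t) ∧ m.OrbitGerm (γ t) (γ s)) (fun r hr => ?_)
    (fun _ _ _ _ _ _ h h' => ⟨h.1.trans h'.1, h'.2.trans h.2⟩) (fun _ _ _ _ h => h.symm)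
    hs ht).1
  obtain ⟨W, hW, hWg⟩ := m.eventually_orbitGerm hreg (γ r)
  filter_upwards [(hγ.continuousOn r hr) hW, self_mem_nhdsWithin] with q hq hq'
  have hrel : ∀ r ∈ Set.Ioo a b, ∀ q ∈ Set.Ioo a b, m.contactForm.SameReebOrbit (γ r) (γ q) :=
    fun r hr q hq => ⟨γ, a, b, r, q, hγ, hr, hq, rfl, rfl⟩
  exact ⟨hWg _ (mem_of_mem_nhds hW) _ hq (hrel r hr q hq'),
    hWg _ hq _ (mem_of_mem_nhds hW) (hrel q hq' r hr)⟩

end OpticalMedium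

/-! ### Topology and smooth structure of the orbit space. -/

namespace OpticalMedium

variable (m : OpticalMedium)

theorem toOrbit_eq_iff {x y : m.Hypersurface} :
    m.contactForm.toOrbit x = m.contactForm.toOrbit y ↔ m.contactForm.SameReebOrbit x y :=
  m.equivalence_sameReebOrbit.quot_mk_eq_iff x y

/-- The saturation of an open `W` is open: if `y` shares an orbit with `x ∈ W`, the germ from `y` to
`x` sends a neighbourhood of `y` into `W` along orbits. -/
theorem isOpenMap_toOrbit (hreg : m.contactForm.IsRegularReeb 4) :
    IsOpenMap m.contactForm.toOrbit := by
  intro W hW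
  refine isQuotientMap_quot_mk.isOpen_preimage.1 (isOpen_iff_mem_nhds.2 ?_)
  rintro y ⟨x, hx, hxy⟩
  obtain ⟨g, -, hg, rfl, ho, -⟩ :=
    m.orbitGerm_of_sameReebOrbit hreg (m.toOrbit_eq_iff.1 hxy.symm)
  filter_upwards [ho, hg.continuousAt (hW.mem_nhds hx)] with w hw hw'
  exact ⟨g w, hw', (m.toOrbit_eq_iff.2 hw).symm⟩

theorem isOpenQuotientMap_toOrbit (hreg : m.contactForm.IsRegularReeb 4) :
    IsOpenQuotientMap m.contactForm.toOrbit :=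
  ⟨Quot.mk_surjective, continuous_quot_mk, m.isOpenMap_toOrbit hreg⟩

/-- A chart of the orbit space is adapted if its composition with the quotient map is smooth and
its inverse lifts to smooth local sections through every point. -/
structure IsAdaptedChart
    (e : OpenPartialHomeomorph m.contactForm.OrbitSpace (EuclideanSpace ℝ (Fin 4))) : Prop where
  smooth : ∀ w, m.contactForm.toOrbit w ∈ e.source →
    ContMDiffAt model (𝓡 4) ∞ (e ∘ m.contactForm.toOrbit) w
  exists_section : ∀ w, m.contactForm.toOrbit w ∈ e.source →
    ∃ σ : EuclideanSpace ℝ (Fin 4) → m.Hypersurface,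
      ContMDiffAt (𝓡 4) model ∞ σ (e (m.contactForm.toOrbit w)) ∧
      σ (e (m.contactForm.toOrbit w)) = w ∧
      ∀ᶠ y in 𝓝 (e (m.contactForm.toOrbit w)), m.contactForm.toOrbit (σ y) = e.symm y

/-- As `f` separates exactly the orbits that meet `U`, it induces a bijection from `π '' U` to `f ''
U`. Local sections of `f` make this image open and the inverse continuous. -/
theorem exists_isAdaptedChart (hreg : m.contactForm.IsRegularReeb 4)
    (z : m.contactForm.OrbitSpace) :
    ∃ e : OpenPartialHomeomorph m.contactForm.OrbitSpace (EuclideanSpace ℝ (Fin 4)),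
      z ∈ e.source ∧ m.IsAdaptedChart e := by
  have hπ := m.isOpenQuotientMap_toOrbit hreg
  obtain ⟨x, rfl⟩ := hπ.surjective z
  obtain ⟨U, hU, hxU, f, hf, hsurj, hfib⟩ := hreg x
  set π := m.contactForm.toOrbit
  have : Nonempty m.Hypersurface := ⟨x⟩
  let a : m.contactForm.OrbitSpace → EuclideanSpace ℝ (Fin 4) := fun z =>
    f (Function.invFunOn π U z)
  let b : EuclideanSpace ℝ (Fin 4) → m.contactForm.OrbitSpace := fun v =>
    π (Function.invFunOn f U v)
  have ha : ∀ u ∈ U, a (π u) = f u := fun u hu => by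
    have h1 : π u ∈ π '' U := ⟨u, hu, rfl⟩
    exact (hfib _ (Function.invFunOn_mem h1) u hu).1
      (m.toOrbit_eq_iff.1 (Function.invFunOn_eq h1))
  have hb : ∀ u ∈ U, b (f u) = π u := fun u hu => by
    have h1 : f u ∈ f '' U := ⟨u, hu, rfl⟩
    exact m.toOrbit_eq_iff.2 ((hfib _ (Function.invFunOn_mem h1) u hu).2
      (Function.invFunOn_eq h1))
  have hsec : ∀ u ∈ U, ∃ σ : EuclideanSpace ℝ (Fin 4) → m.Hypersurface,
      ContMDiffAt (𝓡 4) model ∞ σ (f u) ∧ σ (f u) = u ∧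
      ∀ᶠ y in 𝓝 (f u), σ y ∈ U ∧ f (σ y) = y := fun u hu => by
    obtain ⟨σ, V, hV, hfV, hσ, hσu, h⟩ := exists_localSection hU hu hf (hsurj u hu)
    refine ⟨σ, hσ.contMDiffAt (hV.mem_nhds hfV), hσu, ?_⟩
    filter_upwards [hV.mem_nhds hfV] with y hy using h y hy
  have hbσ : ∀ σ : EuclideanSpace ℝ (Fin 4) → m.Hypersurface, ∀ v,
      (∀ᶠ y in 𝓝 v, σ y ∈ U ∧ f (σ y) = y) → ∀ᶠ y in 𝓝 v, π (σ y) = b y := fun σ v h => by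
    filter_upwards [h] with y hy
    rw [← hb _ hy.1, hy.2]
  have hat : IsOpen (f '' U) := by
    refine isOpen_iff_mem_nhds.2 ?_
    rintro _ ⟨u, hu, rfl⟩
    obtain ⟨σ, -, -, h⟩ := hsec u hu
    filter_upwards [h] with y hy
    exact ⟨σ y, hy⟩
  let e : OpenPartialHomeomorph m.contactForm.OrbitSpace (EuclideanSpace ℝ (Fin 4)) :=
    { toFun := a
      invFun := b
      source := π '' U
      target := f '' U
      map_source' := by
        rintro _ ⟨u, hu, rfl⟩
        exact ⟨u, hu, (ha u hu).symm⟩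
      map_target' := by
        rintro _ ⟨u, hu, rfl⟩
        exact ⟨u, hu, (hb u hu).symm⟩
      left_inv' := by
        rintro _ ⟨u, hu, rfl⟩
        rw [ha u hu, hb u hu]
      right_inv' := by
        rintro _ ⟨u, hu, rfl⟩
        rw [hb u hu, ha u hu]
      open_source := hπ.isOpenMap U hU
      open_target := hat
      continuousOn_toFun := by
        rintro _ ⟨u, hu, rfl⟩
        refine ContinuousAt.continuousWithinAt (hπ.continuousAt_comp_iff.1 ?_)
        refine (hf.contMDiffAt (hU.mem_nhds hu)).continuousAt.congr ?_
        filter_upwards [hU.mem_nhds hu] with w hw using (ha w hw).symm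
      continuousOn_invFun := by
        rintro _ ⟨u, hu, rfl⟩
        obtain ⟨σ, hσ, -, h⟩ := hsec u hu
        exact ((hπ.continuous.continuousAt.comp hσ.continuousAt).congr
          (hbσ σ _ h)).continuousWithinAt }
  refine ⟨e, ⟨x, hxU, rfl⟩, ?_, ?_⟩
  -- The orbit of `w` meets `U` although `w` may lie outside; with a germ `g` from `w` to `u ∈ U`,
  -- the chart composed with `π` is `f ∘ g` near `w`.
  · rintro w ⟨u, hu, huw⟩
    obtain ⟨g, -, hg, rfl, ho, -⟩ :=
      m.orbitGerm_of_sameReebOrbit hreg (m.toOrbit_eq_iff.1 huw.symm)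
    refine ((hf.contMDiffAt (hU.mem_nhds hu)).comp w hg).congr_of_eventuallyEq ?_
    filter_upwards [ho, hg.continuousAt (hU.mem_nhds hu)] with w' hw' hw''
    change a (π w') = f (g w')
    rw [← ha _ hw'']
    exact congrArg a (m.toOrbit_eq_iff.2 hw')
  -- Here the germ goes from `u` to `w` and moves a section through `u` to one through `w`.
  · rintro w ⟨u, hu, huw⟩
    obtain ⟨σ, hσ, hσu, h⟩ := hsec u hu
    obtain ⟨g, -, hg, rfl, ho, -⟩ :=
      m.orbitGerm_of_sameReebOrbit hreg (m.toOrbit_eq_iff.1 huw)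
    have he : e (π (g u)) = f u := by
      exact (congrArg a huw.symm).trans (ha u hu)
    have hg' : ContMDiffAt model model ∞ g (σ (f u)) := by rwa [hσu]
    have ho' : ∀ᶠ w in 𝓝 (σ (f u)), m.contactForm.SameReebOrbit w (g w) := by rwa [hσu]
    rw [he]
    refine ⟨g ∘ σ, hg'.comp _ hσ, congrArg g hσu, ?_⟩
    filter_upwards [hbσ σ _ h, hσ.continuousAt.eventually ho'] with y hy hy'
    exact (m.toOrbit_eq_iff.2 hy').symm.trans hy

/-- Adapted charts define a smooth structure for which the quotient map is a submersion. -/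
theorem exists_isQuotientManifold (hreg : m.contactForm.IsRegularReeb 4)
    (hclosed : IsClosed {z : m.Hypersurface × m.Hypersurface |
      m.contactForm.SameReebOrbit z.1 z.2}) :
    ∃ _ : ChartedSpace (EuclideanSpace ℝ (Fin 4)) m.contactForm.OrbitSpace,
      IsQuotientManifold model (𝓡 4) m.contactForm.toOrbit := by
  have h0 : (∞ : WithTop ℕ∞) ≠ 0 := by simp
  have hπ := m.isOpenQuotientMap_toOrbit hreg
  choose e he hea using m.exists_isAdaptedChart hreg
  let C : ChartedSpace (EuclideanSpace ℝ (Fin 4)) m.contactForm.OrbitSpace :=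
    { atlas := Set.range e
      chartAt := e
      mem_chart_source := he
      chart_mem_atlas := fun z => ⟨z, rfl⟩ }
  have hman : IsManifold (𝓡 4) ∞ m.contactForm.OrbitSpace := by
    refine isManifold_of_contDiffOn _ _ _ ?_
    rintro _ _ ⟨z, rfl⟩ ⟨z', rfl⟩
    intro v hv
    have hv' : v ∈ (e z).target ∧ (e z).symm v ∈ (e z').source := by
      simpa [OpenPartialHomeomorph.trans_source] using hv
    obtain ⟨w, hw⟩ := hπ.surjective ((e z).symm v)
    have hws : m.contactForm.toOrbit w ∈ (e z).source := by
      rw [hw]; exact (e z).map_target hv'.1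
    -- Near `v` the transition map is `(e z' ∘ π) ∘ σ`, a composition of smooth maps.
    obtain ⟨σ, hσ, hσw, hs⟩ := (hea z).exists_section w hws
    have hev : e z (m.contactForm.toOrbit w) = v := by rw [hw, (e z).right_inv hv'.1]
    rw [hev] at hσ hσw hs
    have h1 : ContMDiffAt model (𝓡 4) ∞ (e z' ∘ m.contactForm.toOrbit) (σ v) := by
      rw [hσw]
      exact (hea z').smooth w (by rw [hw]; exact hv'.2)
    refine ((h1.comp v hσ).contDiffAt.congr_of_eventuallyEq ?_).contDiffWithinAt
    filter_upwards [hs] with y hy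
    exact congrArg (e z') hy.symm
  have hsm : ContMDiff model (𝓡 4) ∞ m.contactForm.toOrbit := fun w =>
    contMDiffAt_iff_target.2 ⟨hπ.continuous.continuousAt,
      (hea (m.contactForm.toOrbit w)).smooth w (he _)⟩
  refine ⟨C, ?_, hπ.isQuotientMap.secondCountableTopology hπ.isOpenMap, hman, hsm, fun w => ?_⟩
  · rw [t2Space_iff_of_isOpenQuotientMap hπ]
    simpa only [m.toOrbit_eq_iff] using hclosed
  -- Differentiating `π ∘ (σ ∘ e z) = id` at `z` gives a right inverse of `dπ` at `w`.
  · obtain ⟨σ, hσ, hσw, hs⟩ := (hea (m.contactForm.toOrbit w)).exists_section w (he _)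
    set z := m.contactForm.toOrbit w with hz
    have hc : ContMDiffAt (𝓡 4) (𝓡 4) ∞ (e z) z :=
      contMDiffAt_extChartAt (I := 𝓡 4) (x := z) (n := ∞)
    have h1 : MDifferentiableAt (𝓡 4) model (σ ∘ e z) z :=
      (hσ.comp z hc).mdifferentiableAt h0
    have h2 : m.contactForm.toOrbit ∘ (σ ∘ e z) =ᶠ[𝓝 z] id := by
      filter_upwards [hc.continuousAt.eventually hs, (e z).open_source.mem_nhds (he z)] with y hy hy'
      exact hy.trans ((e z).left_inv hy')
    have h3 : HasMFDerivAt model (𝓡 4) m.contactForm.toOrbit ((σ ∘ e z) z)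
        (mfderiv model (𝓡 4) m.contactForm.toOrbit w) := by
      have : (σ ∘ e z) z = w := hσw
      rw [this]
      exact (hsm.mdifferentiableAt h0).hasMFDerivAt
    have h4 := (h3.comp z h1.hasMFDerivAt).congr_of_eventuallyEq h2.symm
    have h5 := hasMFDerivAt_unique h4 (hasMFDerivAt_id z)
    intro v
    exact ⟨_, DFunLike.congr_fun h5 v⟩

end OpticalMedium

/-! ### The reduced form: existence, smoothness, closedness, non-degeneracy. -/

theorem canonicalTwoForm_comp_apply {E : Type*} [NormedAddCommGroup E] [NormedSpace ℝ E]
    (A : E →L[ℝ] CotangentE3) (v : Fin 2 → E) :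
    canonicalTwoForm.compContinuousLinearMap A v = canonicalPairing (A (v 0)) (A (v 1)) := by
  rw [← canonicalTwoForm_apply, ContinuousAlternatingMap.compContinuousLinearMap_apply]
  congr 1
  ext i : 1
  fin_cases i <;> rfl

section ExactPullback

variable {E : Type*} [NormedAddCommGroup E] [NormedSpace ℝ E] {F : E → CotangentE3} {V : Set E}

/-- The pullback of the Liouville form under a map of vector spaces. -/
noncomputable def liouvillePullback (F : E → CotangentE3) (y : E) : E [⋀^Fin 1]→L[ℝ] ℝ :=
  (liouvilleForm (F y)).compContinuousLinearMap (fderiv ℝ F y)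

theorem contDiffOn_liouvillePullback (hV : IsOpen V) (hF : ContDiffOn ℝ ∞ F V) :
    ContDiffOn ℝ ∞ (liouvillePullback F) V := by
  have h1 : ContDiffOn ℝ ∞ (fun y => (liouvilleCovector (F y)).comp (fderiv ℝ F y)) V :=
    (liouvilleCovector.contDiff.comp_contDiffOn hF).clm_comp (hF.fderiv_of_isOpen hV le_rfl)
  exact (ContinuousAlternatingMap.ofSubsingletonLIE (0 : Fin 1) :
    (E →L[ℝ] ℝ) ≃ₗᵢ[ℝ] _).contDiff.comp_contDiffOn h1

theorem extDeriv_liouvillePullback {y : E} (hF : ContDiffAt ℝ ∞ F y) :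
    extDeriv (liouvillePullback F) y =
      canonicalTwoForm.compContinuousLinearMap (fderiv ℝ F y) := by
  rw [← extDeriv_liouvilleForm (F y)]
  exact extDeriv_pullback liouvilleForm.differentiableAt hF
    (by rw [minSmoothness_of_isRCLikeNormedField]; exact WithTop.coe_le_coe.2 le_top)

theorem contDiffOn_extDeriv {k : ℕ} {β : E → E [⋀^Fin k]→L[ℝ] ℝ} (hV : IsOpen V)
    (hβ : ContDiffOn ℝ ∞ β V) : ContDiffOn ℝ ∞ (extDeriv β) V :=
  (ContinuousAlternatingMap.alternatizeUncurryFinCLM ℝ E ℝ).contDiff.comp_contDiffOn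
    (hβ.fderiv_of_isOpen hV le_rfl)

end ExactPullback

namespace OpticalMedium

variable (m : OpticalMedium) [ChartedSpace (EuclideanSpace ℝ (Fin 4)) m.contactForm.OrbitSpace]

/-- The differential of the quotient map. -/
noncomputable def dorbit (x : m.Hypersurface) :
    E3 × EuclideanSpace ℝ (Fin 2) →L[ℝ] EuclideanSpace ℝ (Fin 4) :=
  mfderiv model (𝓡 4) m.contactForm.toOrbit x

variable {m}

theorem exists_eq_smul_reeb_of_dorbit_eq_zero
    (h : IsQuotientManifold model (𝓡 4) m.contactForm.toOrbit) {x : m.Hypersurface}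
    {v : E3 × EuclideanSpace ℝ (Fin 2)} (hv : m.dorbit x v = 0) : ∃ c : ℝ, v = c • m.reeb x :=
  m.exists_eq_smul_reeb_of_mem_ker (h.smooth.mdifferentiableAt (by simp)) (h.submersion x)
    (Filter.Eventually.of_forall fun _ hy => (m.toOrbit_eq_iff.2 hy).symm) hv

theorem dorbit_reeb (h : IsQuotientManifold model (𝓡 4) m.contactForm.toOrbit)
    (x : m.Hypersurface) : m.dorbit x (m.reeb x) = 0 :=
  m.contactForm.mfderiv_reebField_eq_zero m.contMDiff_one_reebField
    (h.smooth.mdifferentiableAt (by simp))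
    (Filter.Eventually.of_forall fun _ hy => (m.toOrbit_eq_iff.2 hy).symm)

/-- The form `dα` descends to the orbit space. -/
theorem exists_orbitForm (hreg : m.contactForm.IsRegularReeb 4)
    (h : IsQuotientManifold model (𝓡 4) m.contactForm.toOrbit) (z : m.contactForm.OrbitSpace) :
    ∃ η : EuclideanSpace ℝ (Fin 4) [⋀^Fin 2]→L[ℝ] ℝ, ∀ x, m.contactForm.toOrbit x = z →
      η.compContinuousLinearMap (m.dorbit x) =
        canonicalTwoForm.compContinuousLinearMap (m.dincl x) := by
  have h0 : (∞ : WithTop ℕ∞) ≠ 0 := by simp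
  obtain ⟨x₀, rfl⟩ := (m.isOpenQuotientMap_toOrbit hreg).surjective z
  obtain ⟨B, hB⟩ := (m.dorbit x₀).toLinearMap.exists_rightInverse_of_surjective
    (LinearMap.range_eq_top.2 (h.submersion x₀))
  let B' : EuclideanSpace ℝ (Fin 4) →L[ℝ] E3 × EuclideanSpace ℝ (Fin 2) :=
    LinearMap.toContinuousLinearMap B
  have hB' : ∀ a, m.dorbit x₀ (B' a) = a := fun a => LinearMap.congr_fun hB a
  -- The value is defined by lifting vectors through a right inverse of `dπ` at one point `x₀` of
  -- the orbit.
  refine ⟨canonicalTwoForm.compContinuousLinearMap ((m.dincl x₀).comp B'), fun x hx => ?_⟩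
  obtain ⟨g, D, hg, rfl, ho, hD, hp⟩ := m.orbitGerm_of_sameReebOrbit hreg (m.toOrbit_eq_iff.1 hx)
  have hdπ : (m.dorbit (g x)).comp D = m.dorbit x := by
    have h1 := (h.smooth.mdifferentiableAt (x := g x) h0).hasMFDerivAt.comp x hD
    have h2 : m.contactForm.toOrbit =ᶠ[𝓝 x] m.contactForm.toOrbit ∘ g := by
      filter_upwards [ho] with w hw
      exact m.toOrbit_eq_iff.2 hw
    exact (h1.congr_of_eventuallyEq h2).mfderiv.symm
  -- By `hdπ`, `D v` and the chosen lift have the same image under `dπ`. They differ by a Reeb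
  -- multiple, invisible to `dα`, and `D` preserves `dα`.
  have hlift : ∀ v, ∃ c : ℝ, B' (m.dorbit x v) = D v + c • m.reeb (g x) := fun v => by
    obtain ⟨c, hc⟩ := exists_eq_smul_reeb_of_dorbit_eq_zero h
      (x := g x) (v := B' (m.dorbit x v) - D v) (by
        rw [map_sub, hB', ← hdπ, ContinuousLinearMap.comp_apply, sub_self])
    exact ⟨c, by rw [← hc]; abel⟩
  ext v
  rw [ContinuousAlternatingMap.compContinuousLinearMap_apply, canonicalTwoForm_comp_apply,
    canonicalTwoForm_comp_apply]
  simp only [Function.comp_apply, ContinuousLinearMap.comp_apply]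
  obtain ⟨c, hc⟩ := hlift (v 0)
  obtain ⟨c', hc'⟩ := hlift (v 1)
  have hreeb : ∀ a, canonicalPairing (m.dincl (g x) a) (m.dincl (g x) (m.reeb (g x))) = 0 :=
    fun a => by rw [canonicalPairing_antisymm, m.canonicalPairing_reeb, neg_zero]
  rw [hc, hc', ← hp]
  simp only [map_add, map_smul, add_apply, smul_apply, m.canonicalPairing_reeb, hreeb, smul_zero,
    add_zero]

variable (m)

/-- The reduced two-form on the orbit space, with values in the forms on the model space. -/
def IsReducedForm
    (η : m.contactForm.OrbitSpace → EuclideanSpace ℝ (Fin 4) [⋀^Fin 2]→L[ℝ] ℝ) : Prop :=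
  ∀ x, (η (m.contactForm.toOrbit x)).compContinuousLinearMap (m.dorbit x) =
    canonicalTwoForm.compContinuousLinearMap (m.dincl x)

variable {m}

/-- The smooth structure is now an arbitrary one with `IsQuotientManifold`, so sections come from
the submersion `φ ∘ π` to `ℝ⁴` and not from adapted charts. -/
theorem exists_localSection_toOrbit (h : IsQuotientManifold model (𝓡 4) m.contactForm.toOrbit)
    (z₀ : m.contactForm.OrbitSpace) {y : EuclideanSpace ℝ (Fin 4)}
    (hy : y ∈ (extChartAt (𝓡 4) z₀).target) :
    ∃ (σ : EuclideanSpace ℝ (Fin 4) → m.Hypersurface) (V : Set (EuclideanSpace ℝ (Fin 4))),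
      IsOpen V ∧ y ∈ V ∧ V ⊆ (extChartAt (𝓡 4) z₀).target ∧ ContMDiffOn (𝓡 4) model ∞ σ V ∧
      ∀ y' ∈ V, m.contactForm.toOrbit (σ y') = (extChartAt (𝓡 4) z₀).symm y' := by
  have h0 : (∞ : WithTop ℕ∞) ≠ 0 := by simp
  have := h.isManifold
  have : IsManifold (𝓡 4) 1 m.contactForm.OrbitSpace :=
    IsManifold.of_le (n := ∞) (WithTop.coe_le_coe.2 le_top)
  set φ := extChartAt (𝓡 4) z₀
  obtain ⟨x, hx⟩ := Quot.mk_surjective (φ.symm y)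
  change m.contactForm.toOrbit x = φ.symm y at hx
  have hsource : IsOpen (m.contactForm.toOrbit ⁻¹' φ.source) :=
    (isOpen_extChartAt_source z₀).preimage h.smooth.continuous
  have hxs : m.contactForm.toOrbit x ∈ φ.source := by rw [hx]; exact φ.map_target hy
  have hφx : (φ ∘ m.contactForm.toOrbit) x = y := by
    rw [Function.comp_apply, hx, φ.right_inv hy]
  have hφ : ContMDiffOn (𝓡 4) (𝓡 4) ∞ φ φ.source := by
    have := contMDiffOn_extChartAt (I := 𝓡 4) (n := ∞) (x := z₀)
    rwa [← extChartAt_source (𝓡 4)] at this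
  have hf : ContMDiffOn model (𝓡 4) ∞ (φ ∘ m.contactForm.toOrbit)
      (m.contactForm.toOrbit ⁻¹' φ.source) :=
    hφ.comp h.smooth.contMDiffOn fun w hw => hw
  have hsurj : Function.Surjective (mfderiv model (𝓡 4) (φ ∘ m.contactForm.toOrbit) x) := by
    have h1 := mfderiv_comp x
      ((hφ.contMDiffAt ((isOpen_extChartAt_source z₀).mem_nhds hxs)).mdifferentiableAt h0)
      (h.smooth.mdifferentiableAt (x := x) h0)
    have h2 : Function.Surjective (mfderiv (𝓡 4) (𝓡 4) φ (m.contactForm.toOrbit x)) :=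
      (isInvertible_mfderiv_extChartAt hxs).bijective.surjective
    rw [h1]
    exact h2.comp (h.submersion x)
  obtain ⟨σ, V, hV, hxV, hσ, -, hσV⟩ := exists_localSection hsource hxs hf hsurj
  rw [hφx] at hxV
  refine ⟨σ, V ∩ φ.target, hV.inter (isOpen_extChartAt_target z₀), ⟨hxV, hy⟩,
    Set.inter_subset_right, hσ.mono Set.inter_subset_left, fun y' hy' => ?_⟩
  obtain ⟨h1, h2⟩ := hσV y' hy'.1
  exact φ.injOn h1 (φ.map_target hy'.2) (h2.trans (φ.right_inv hy'.2).symm)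

/-- In a chart, the reduced form is the exterior derivative of a pullback of the Liouville form. -/
theorem IsReducedForm.inChart_eq
    {η : m.contactForm.OrbitSpace → EuclideanSpace ℝ (Fin 4) [⋀^Fin 2]→L[ℝ] ℝ}
    (hη : m.IsReducedForm η) (h : IsQuotientManifold model (𝓡 4) m.contactForm.toOrbit)
    (z₀ : m.contactForm.OrbitSpace) {y : EuclideanSpace ℝ (Fin 4)}
    (hy : y ∈ (extChartAt (𝓡 4) z₀).target) :
    ∃ (V : Set (EuclideanSpace ℝ (Fin 4)))
      (β : EuclideanSpace ℝ (Fin 4) → EuclideanSpace ℝ (Fin 4) [⋀^Fin 1]→L[ℝ] ℝ),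
      IsOpen V ∧ y ∈ V ∧ ContDiffOn ℝ ∞ β V ∧
      Set.EqOn (DiffForm.inChart (I := 𝓡 4) η z₀) (extDeriv β) V := by
  have h0 : (∞ : WithTop ℕ∞) ≠ 0 := by simp
  obtain ⟨σ, V, hV, hyV, hVt, hσ, hs⟩ := exists_localSection_toOrbit h z₀ hy
  have hF : ContDiffOn ℝ ∞ (m.incl ∘ σ) V :=
    (m.contMDiff_incl.comp_contMDiffOn hσ).contDiffOn
  refine ⟨V, liouvillePullback (m.incl ∘ σ), hV, hyV, contDiffOn_liouvillePullback hV hF,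
    fun y' hy' => ?_⟩
  rw [extDeriv_liouvillePullback (hF.contDiffAt (hV.mem_nhds hy'))]
  have hσd : MDifferentiableAt (𝓡 4) model σ y' :=
    (hσ.contMDiffAt (hV.mem_nhds hy')).mdifferentiableAt h0
  let S : EuclideanSpace ℝ (Fin 4) →L[ℝ] E3 × EuclideanSpace ℝ (Fin 2) :=
    mfderiv (𝓡 4) model σ y'
  let T : EuclideanSpace ℝ (Fin 4) →L[ℝ] EuclideanSpace ℝ (Fin 4) :=
    mfderivWithin (𝓡 4) (𝓡 4) (extChartAt (𝓡 4) z₀).symm (Set.range (𝓡 4)) y'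
  -- Since the inverse chart is `π ∘ σ` near `y'`, the chart expression of `η` is `σ^* π^* η = σ^*
  -- dα = d((incl ∘ σ)^* θ)`.
  have hT : T = (m.dorbit (σ y')).comp S := by
    have h1 := mfderiv_comp y' (h.smooth.mdifferentiableAt h0) hσd
    have h2 : (extChartAt (𝓡 4) z₀).symm =ᶠ[𝓝 y'] m.contactForm.toOrbit ∘ σ := by
      filter_upwards [hV.mem_nhds hy'] with w hw using (hs w hw).symm
    have h3 := h2.mfderiv_eq.trans h1
    have h4 : T = mfderiv (𝓡 4) (𝓡 4) (extChartAt (𝓡 4) z₀).symm y' := by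
      simp only [T]
      rw [(𝓡 4).range_eq_univ, mfderivWithin_univ]
    exact h4.trans h3
  have hd : fderiv ℝ (m.incl ∘ σ) y' = (m.dincl (σ y')).comp S := by
    have h1 := mfderiv_comp y' (m.contMDiff_incl.mdifferentiableAt h0) hσd
    rw [mfderiv_eq_fderiv] at h1
    exact h1
  have h5 : (η (m.contactForm.toOrbit (σ y'))).compContinuousLinearMap T =
      canonicalTwoForm.compContinuousLinearMap (fderiv ℝ (m.incl ∘ σ) y') := by
    rw [hT, hd]
    exact congrArg (fun ξ => ξ.compContinuousLinearMap S) (hη (σ y'))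
  rw [hs y' hy'] at h5
  exact h5

/-- Local exactness gives smoothness and closedness. For non-degeneracy, a lift of a vector in the
kernel lies in the kernel of `dα`, the Reeb line, which `dπ` sends to zero. -/
theorem IsReducedForm.isSymplectic
    {η : m.contactForm.OrbitSpace → EuclideanSpace ℝ (Fin 4) [⋀^Fin 2]→L[ℝ] ℝ}
    (hη : m.IsReducedForm η) (h : IsQuotientManifold model (𝓡 4) m.contactForm.toOrbit) :
    DiffForm.IsSymplectic (I := 𝓡 4) (M := m.contactForm.OrbitSpace) η where
  smooth z₀ y hy := by
    obtain ⟨V, β, hV, hyV, hβ, heq⟩ := hη.inChart_eq h z₀ hy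
    exact (((contDiffOn_extDeriv hV hβ).congr heq).contDiffAt
      (hV.mem_nhds hyV)).contDiffWithinAt
  closed := by
    funext z
    obtain ⟨V, β, hV, hzV, hβ, heq⟩ := hη.inChart_eq h z (mem_extChartAt_target z)
    have h1 : DiffForm.inChart (I := 𝓡 4) η z =ᶠ[𝓝 (extChartAt (𝓡 4) z z)] extDeriv β :=
      heq.eventuallyEq_of_mem (hV.mem_nhds hzV)
    have h2 : extDerivWithin (DiffForm.inChart (I := 𝓡 4) η z) (Set.range (𝓡 4))
        (extChartAt (𝓡 4) z z) = 0 := by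
      rw [(𝓡 4).range_eq_univ, extDerivWithin_univ, h1.extDeriv_eq]
      exact extDeriv_extDeriv_apply (hβ.contDiffAt (hV.mem_nhds hzV))
        (by rw [minSmoothness_of_isRCLikeNormedField]; exact WithTop.coe_le_coe.2 le_top)
    unfold DiffForm.extDeriv
    rw [h2]
    rfl
  nondegenerate z v hv := by
    obtain ⟨x, rfl⟩ := Quot.mk_surjective z
    obtain ⟨u, rfl⟩ := h.submersion x v
    obtain ⟨c, rfl⟩ := m.exists_eq_smul_reeb x u fun w => by
      have h1 := (DFunLike.congr_fun (hη x) ![u, w]).trans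
        (canonicalTwoForm_comp_apply (m.dincl x) ![u, w])
      refine h1.symm.trans (Eq.trans ?_ (hv (m.dorbit x w)))
      refine congrArg (η (m.contactForm.toOrbit x)) ?_
      ext i : 1
      fin_cases i <;> rfl
    have h2 : m.dorbit x (c • m.reeb x) = 0 := by rw [map_smul, dorbit_reeb h, smul_zero]
    exact h2

end OpticalMedium

theorem mainTheorem2 (m : OpticalMedium)
    (hreg : m.contactForm.IsRegularReeb 4)
    (hclosed : IsClosed {z : m.Hypersurface × m.Hypersurface |
      m.contactForm.SameReebOrbit z.1 z.2}) :
    (∀ x : m.Hypersurface, ∃! v, m.contactForm.IsReebVector x v) ∧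
    Equivalence m.contactForm.SameReebOrbit ∧
    (∃ _ : ChartedSpace (EuclideanSpace ℝ (Fin 4)) m.contactForm.OrbitSpace,
      IsQuotientManifold OpticalMedium.model (𝓡 4) m.contactForm.toOrbit) ∧
    ∀ [ChartedSpace (EuclideanSpace ℝ (Fin 4)) m.contactForm.OrbitSpace],
      IsQuotientManifold OpticalMedium.model (𝓡 4) m.contactForm.toOrbit →
      ∃ η : DiffForm (𝓡 4) m.contactForm.OrbitSpace 2,
        η.pullback m.contactForm.toOrbit = m.contactForm.extDeriv ∧
        η.IsSymplectic ∧
        ∀ η' : DiffForm (𝓡 4) m.contactForm.OrbitSpace 2,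
          η'.pullback m.contactForm.toOrbit = m.contactForm.extDeriv → η' = η := by
  refine ⟨m.existsUnique_isReebVector, m.equivalence_sameReebOrbit,
    m.exists_isQuotientManifold hreg hclosed, fun {_} h => ?_⟩
  choose η hη using OpticalMedium.exists_orbitForm hreg h
  have hred : m.IsReducedForm η := fun x => hη _ x rfl
  have hpull : DiffForm.pullback (I := OpticalMedium.model) (J := 𝓡 4) m.contactForm.toOrbit η =
      m.contactForm.extDeriv :=
    funext fun x => (hred x).trans (m.extDeriv_contactForm x).symm
  refine ⟨η, hpull, hred.isSymplectic h, fun η' hη' => ?_⟩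
  funext z
  obtain ⟨x, rfl⟩ := (m.isOpenQuotientMap_toOrbit hreg).surjective z
  have hx := congrFun (hη'.trans hpull.symm) x
  refine ContinuousAlternatingMap.ext fun v => ?_
  -- Every tuple of tangent vectors at `π x` lifts through `dπ`, so `π^*` is injective on all forms,
  -- smooth or not.
  choose u hu using fun i => h.submersion x (v i)
  have := DFunLike.congr_fun hx u
  have hv : v = fun i => mfderiv OpticalMedium.model (𝓡 4) m.contactForm.toOrbit x (u i) :=
    funext fun i => (hu i).symm
  rw [hv]
  exact this
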